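/- Let $\lambda>0$ and $\frac{2\lambda}{2\lambda+1}<p\le 1$, and put $c_\lambda^{-1}=2^{\lambda+1/2}\Gamma(\lambda+\tfrac12)$. For $y>0$ and $x,t\in\mathbb R$ consider the $\lambda$-Poisson kernel and the conjugate $\lambda$-Poisson kernel $$(\tau_xP_y)(-t)=\frac{\lambda\Gamma(\lambda+1/2)}{2^{-\lambda-1/2}\pi}\int_0^\pi\frac{y\,(1+\operatorname{sgn}(xt)\cos\theta)}{(y^2+x^2+t^2-2|xt|\cos\theta)^{\lambda+1}}\sin^{2\lambda-1}\theta\,d\theta,$$ $$(\tau_xQ_y)(-t)=\frac{\lambda\Gamma(\lambda+1/2)}{2^{-\lambda-1/2}\pi}\int_0^\pi\frac{(x-t)(1+\operatorname{sgn}(xt)\cos\theta)}{(y^2+x^2+t^2-2|xt|\cos\theta)^{\lambda+1}}\sin^{2\lambda-1}\theta\,d\theta,$$ and the corresponding integrals $$(Pf)(x,y)=c_\lambda\int_{\mathbb R}f(t)(\tau_xP_y)(-t)|t|^{2\lambda}\,dt,\qquad (Qf)(x,y)=c_\lambda\int_{\mathbb R}f(t)(\tau_xQ_y)(-t)|t|^{2\lambda}\,dt.$$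 For $x_0\in\mathbb R$ and $\delta_0>0$ let $I(x_0,\delta_0)=\{x\in\mathbb R:|x-x_0|<\delta_0\}$ and $|I(x_0,\delta_0)|_\lambda=\int_{I(x_0,\delta_0)}|x|^{2\lambda}\,dx$. A Lebesgue measurable function $a:\mathbb R\to\mathbb C$ is called a $p_\lambda$-atom with constant $A>0$ if there are $x_0\in\mathbb R$, $0<\delta_0<|x_0/2|$ and an integer $\kappa\ge 2\left\lfloor(2\lambda+1)\frac{1-p}{p}\right\rfloor$ such that (i) $\|a\|_{L^\infty}\le A\,|I(x_0,\delta_0)|_\lambda^{-1/p}$; (ii) $a$ vanishes outside $I(x_0,\delta_0)$; (iii) $\int_{\mathbb R}t^k a(t)|t|^{2\lambda}\,dt=0$ for $k=0,1,\dots,\kappa$. Then there is a constant $C>0$, depending only on $\lambda$ and $p$, such that for every $A>0$ and every $p_\lambda$-atom $a$ with constant $A$, the functions $y\mapsto (Pa)(x,y)$ and $y\mapsto (Qa)(x,y)$ are differentiable on $(0,\infty)$ for every $x\in\mathbb R$, and for every $y>0$ $$\left(\int_{\mathbb R}\left|\partial_y (Pa)(x,y)\right|^p|x|^{2\lambda}\,dx\right)^{1/p}\le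 \frac{CA}{y},\qquad \left(\int_{\mathbb R}\left|\partial_y (Qa)(x,y)\right|^p|x|^{2\lambda}\,dx\right)^{1/p}\le \frac{CA}{y}.$$ -/

import Mathlib

open MeasureTheory Real
open scoped ENNReal

namespace DunklLine

noncomputable section

/-- The normalizing constant `c_λ`, given by `c_λ⁻¹ = 2 ^ (λ + 1/2) Γ(λ + 1/2)`. -/
def cConst (lam : ℝ) : ℝ := ((2 : ℝ) ^ (lam + 1 / 2) * Real.Gamma (lam + 1 / 2))⁻¹

/-- The `λ`-Poisson kernel `(τ_x P_y)(-t)`. -/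
def poissonKernel (lam y x t : ℝ) : ℝ :=
  lam * Real.Gamma (lam + 1 / 2) / ((2 : ℝ) ^ (-lam - 1 / 2) * π) *
    ∫ θ in (0 : ℝ)..π,
      y * (1 + Real.sign (x * t) * Real.cos θ) /
          (y ^ 2 + x ^ 2 + t ^ 2 - 2 * |x * t| * Real.cos θ) ^ (lam + 1) *
        Real.sin θ ^ (2 * lam - 1)

/-- The conjugate `λ`-Poisson kernel `(τ_x Q_y)(-t)`. -/
def conjPoissonKernel (lam y x t : ℝ) : ℝ :=
  lam * Real.Gamma (lam + 1 / 2) / ((2 : ℝ) ^ (-lam - 1 / 2) * π) *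
    ∫ θ in (0 : ℝ)..π,
      (x - t) * (1 + Real.sign (x * t) * Real.cos θ) /
          (y ^ 2 + x ^ 2 + t ^ 2 - 2 * |x * t| * Real.cos θ) ^ (lam + 1) *
        Real.sin θ ^ (2 * lam - 1)

/-- The `λ`-Poisson integral
`(P f)(x, y) = c_λ ∫ f(t) (τ_x P_y)(-t) |t| ^ (2 λ) dt`. -/
def poissonIntegral (lam : ℝ) (f : ℝ → ℂ) (x y : ℝ) : ℂ :=
  cConst lam • ∫ t : ℝ, (poissonKernel lam y x t * |t| ^ (2 * lam)) • f t

/-- The conjugate `λ`-Poisson integral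
`(Q f)(x, y) = c_λ ∫ f(t) (τ_x Q_y)(-t) |t| ^ (2 λ) dt`. -/
def conjPoissonIntegral (lam : ℝ) (f : ℝ → ℂ) (x y : ℝ) : ℂ :=
  cConst lam • ∫ t : ℝ, (conjPoissonKernel lam y x t * |t| ^ (2 * lam)) • f t

/-- The weighted length `|I(x₀, δ₀)|_λ = ∫_I |x| ^ (2 λ) dx` of the open interval
`I(x₀, δ₀)` with center `x₀` and radius `δ₀`. -/
def intervalMass (lam x₀ δ₀ : ℝ) : ℝ := ∫ x in Metric.ball x₀ δ₀, |x| ^ (2 * lam)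

/-- `a` is a `p_λ`-atom; `A` is the implicit constant of the size condition
`‖a‖_∞ ≤ A |I(x₀, δ₀)|_λ ^ (-1/p)`. -/
def IsAtom (lam p A : ℝ) (a : ℝ → ℂ) : Prop :=
  AEStronglyMeasurable a volume ∧
    ∃ x₀ δ₀ : ℝ, 0 < δ₀ ∧ δ₀ < |x₀ / 2| ∧
      eLpNorm a ∞ volume ≤ ENNReal.ofReal (A / intervalMass lam x₀ δ₀ ^ (1 / p)) ∧
      Function.support a ⊆ Metric.ball x₀ δ₀ ∧
      ∃ κ : ℕ, 2 * ⌊(2 * lam + 1) * ((1 - p) / p)⌋ ≤ (κ : ℤ) ∧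
        ∀ k : ℕ, k ≤ κ → ∫ t : ℝ, (t ^ k * |t| ^ (2 * lam)) • a t = 0

/-- The weighted quasi-norm `(∫ |f(x)| ^ p |x| ^ (2 λ) dx) ^ (1/p)`, with values in `[0, ∞]`. -/
def weightedLpNorm (lam p : ℝ) (f : ℝ → ℂ) : ℝ≥0∞ :=
  (∫⁻ x : ℝ, ENNReal.ofReal (‖f x‖ ^ p * |x| ^ (2 * lam))) ^ (1 / p)

end

end DunklLine

namespace DunklLine

/-! ### Polynomial approximation of powers of a quadratic -/

/-! Write D for the quadratic `quad x y t θ` in the denominators. Since δ₀ < |x₀|/2, the support of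
an atom stays on one side of the origin, so sgn(xt) and the sign of t are constant there. For fixed
θ the kernel is then a smooth function of t, and D is a monic quadratic polynomial in t.
Differentiation under the integral turns the y-derivative into a double integral over (t, θ), which
is estimated in two regimes.

Near ±x₀, where ||x| - |x₀|| < 4δ₀, only size matters. The differentiated integrands are
O(D^(-λ-1)). Integrating in θ gives a multiple of (y² + (|x| - |t|)²)⁻¹ (y² + x² + t²)^(-λ)
(`integral_angular_le`). The second factor absorbs |t|^(2λ), and the first has t-integral at most
2π/y (`norm_integral_prod_le_local`).

Away from ±x₀ the moments are used at each fixed θ. Expanding a power of D around t = x₀ by the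
binomial series in the relative increment, itself quadratic in t, gives a polynomial of degree at
most 2N with relative error (δ₀/√D)^(N+1); this is why 2N vanishing moments are required. One factor
1/√D is traded for 1/y, and the angular integral leaves the decay ||x| - |x₀||^(-(N+2)) (x² +
x₀²)^(-λ) (`norm_integral_prod_le_far`).

Both bounds, raised to the power p and weighted, lie below a bump δ₀⁻¹(1 + ||x| - |x₀||/δ₀)^(-γ)
with γ = (N+2)p - 2λ(1-p). Its integral does not depend on the atom, and γ > 1 means exactly N + 1 >
(2λ+1)(1-p)/p, which N = ⌊(2λ+1)(1-p)/p⌋ satisfies (`exists_weightedLpNorm_le`). `exists_atom_bound`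
runs the argument for an abstract kernel, so that P and Q are two instances. -/

theorem exists_polynomial_approx_one_add_rpow (a : ℝ) (n : ℕ) :
    ∃ C : ℝ, 0 < C ∧ ∃ q : Polynomial ℝ, (n = 0 → q = 0) ∧ q.natDegree ≤ n - 1 ∧
      ∀ w : ℝ, |w| ≤ 9 / 16 → |(1 + w) ^ (-a) - q.eval w| ≤ C * |w| ^ n := by
  have h := Real.one_add_rpow_hasFPowerSeriesOnBall_zero (a := -a)
  -- Any radius strictly between 9/16 and 1 would do: below the radius of convergence, yet
  -- containing all admissible w.
  have hr : (((3 / 4 : NNReal)) : ℝ≥0∞) < 1 := by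
    rw [← ENNReal.coe_one, ENNReal.coe_lt_coe, div_lt_one (by norm_num)]
    norm_num
  obtain ⟨b, hb, C, hC, hbd⟩ := h.uniform_geometric_approx' hr
  refine ⟨C * (b * (4 / 3)) ^ n, by have := hb.1; positivity,
    ∑ j ∈ Finset.range n, Polynomial.monomial j ((binomialSeries ℝ (-a)).coeff j), ?_, ?_, ?_⟩
  · rintro rfl; simp
  · refine Polynomial.natDegree_sum_le_of_forall_le _ _ fun i hi => ?_
    refine (Polynomial.natDegree_monomial_le _).trans ?_
    have := Finset.mem_range.1 hi
    omega
  · intro w hw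
    have hw' : w ∈ Metric.ball (0 : ℝ) ((3 / 4 : NNReal) : ℝ) := by
      rw [mem_ball_zero_iff, Real.norm_eq_abs]
      push_cast
      linarith
    have := hbd w hw' n
    simp only [zero_add, FormalMultilinearSeries.partialSum, Real.norm_eq_abs] at this
    rw [Polynomial.eval_finsetSum]
    simp only [Polynomial.eval_monomial]
    refine le_trans (le_of_eq ?_) (this.trans (le_of_eq ?_))
    · congr 2
      refine Finset.sum_congr rfl fun j _ => ?_
      rw [FormalMultilinearSeries.apply_eq_pow_smul_coeff, smul_eq_mul, mul_comm]
    · push_cast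
      rw [mul_assoc, ← mul_pow]
      congr 2
      ring

/-- Factor out D and apply the binomial approximation to the relative increment. The conditions m² ≤
D and 4δ ≤ √D bound that increment by 2/4 + 1/16 = 9/16 and also by 3δ/√D. The clause for n = 0 is
needed by the conjugate kernel, where q gets multiplied by a linear factor: truncated subtraction
alone would still allow a nonzero constant. -/
theorem exists_polynomial_approx_quadratic_rpow (a : ℝ) (n : ℕ) :
    ∃ C : ℝ, 0 < C ∧ ∀ D m x₀ δ : ℝ, 0 < D → m ^ 2 ≤ D → 0 ≤ δ → 16 * δ ^ 2 ≤ D →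
      ∃ q : Polynomial ℝ, (n = 0 → q = 0) ∧ q.natDegree ≤ 2 * (n - 1) ∧
        ∀ t : ℝ, |t - x₀| ≤ δ →
          |(D + 2 * m * (t - x₀) + (t - x₀) ^ 2) ^ (-a) - q.eval t| ≤
            C * D ^ (-a) * (δ / √D) ^ n := by
  obtain ⟨C, hC, q, hq0, hqd, hq⟩ := exists_polynomial_approx_one_add_rpow a n
  refine ⟨C * 3 ^ n, by positivity, fun D m x₀ δ hD hm hδ hδD => ?_⟩
  set r : Polynomial ℝ := Polynomial.C (2 * m / D) * (Polynomial.X - Polynomial.C x₀) +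
    Polynomial.C (1 / D) * (Polynomial.X - Polynomial.C x₀) ^ 2 with hr
  have hrd : r.natDegree ≤ 2 := by rw [hr]; compute_degree
  refine ⟨Polynomial.C (D ^ (-a)) * q.comp r, ?_, ?_, ?_⟩
  · intro hn; simp [hq0 hn]
  · refine (Polynomial.natDegree_C_mul_le _ _).trans ?_
    rw [Polynomial.natDegree_comp, mul_comm]
    exact Nat.mul_le_mul hrd hqd
  · intro t ht
    set h := t - x₀ with hh
    have hev : r.eval t = (2 * m * h + h ^ 2) / D := by
      simp [hr, hh]; ring
    have hsD : 0 < √D := Real.sqrt_pos.2 hD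
    have hsq : √D ^ 2 = D := Real.sq_sqrt hD.le
    have hms : |m| ≤ √D := Real.abs_le_sqrt hm
    have hδs : 4 * δ ≤ √D := by
      apply Real.le_sqrt_of_sq_le; nlinarith
    have hz : δ / √D ≤ 1 / 4 := by rw [div_le_iff₀ hsD]; linarith
    have hz0 : 0 ≤ δ / √D := by positivity
    have hw : |r.eval t| ≤ 2 * (δ / √D) + (δ / √D) ^ 2 := by
      rw [hev, abs_div, abs_of_pos hD, div_le_iff₀ hD]
      have e : (2 * (δ / √D) + (δ / √D) ^ 2) * D = 2 * √D * δ + δ ^ 2 := by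
        have e' : δ / √D * √D = δ := div_mul_cancel₀ _ hsD.ne'
        calc _ = 2 * √D * (δ / √D * √D) + (δ / √D * √D) ^ 2 := by
              linear_combination (-(2 * (δ / √D) + (δ / √D) ^ 2)) * hsq
          _ = _ := by rw [e']
      rw [e]
      refine (abs_add_le _ _).trans ?_
      rw [abs_mul, abs_mul, abs_two, abs_pow]
      have := abs_nonneg h
      gcongr
    have hw1 : |r.eval t| ≤ 9 / 16 := by nlinarith
    have hw2 : |r.eval t| ≤ 3 * (δ / √D) := by nlinarith
    have hfac : D + 2 * m * h + h ^ 2 = D * (1 + r.eval t) := by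
      rw [hev]; field_simp; ring
    have hpos : 0 ≤ 1 + r.eval t := by have := (abs_le.1 hw1).1; linarith
    rw [hfac, Real.mul_rpow hD.le hpos, Polynomial.eval_mul, Polynomial.eval_C,
      Polynomial.eval_comp, ← mul_sub, abs_mul, abs_of_pos (Real.rpow_pos_of_pos hD _)]
    calc D ^ (-a) * |(1 + r.eval t) ^ (-a) - q.eval (r.eval t)|
        ≤ D ^ (-a) * (C * (3 * (δ / √D)) ^ n) := by
          gcongr
          refine (hq _ hw1).trans ?_
          gcongr
      _ = _ := by rw [mul_pow]; ring

/-! ### The angular integral -/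

/-- With v = 1 - cos θ, the quotient v/(E + 2Xv) has v-derivative E/(E + 2Xv)², so the integrand
with exponent exactly λ + 1 has an elementary primitive. -/
theorem hasDerivAt_angular_primitive {lam E X θ : ℝ} (hlam : 0 < lam) (hE : 0 < E) (hX : 0 ≤ X)
    (hθ : θ ∈ Set.Ioo 0 (π / 2)) :
    HasDerivAt (fun θ => ((1 - cos θ) / (E + 2 * X * (1 - cos θ))) ^ lam / (lam * E))
      (sin θ * (1 - cos θ) ^ (lam - 1) * (E + 2 * X * (1 - cos θ)) ^ (-(lam + 1))) θ := by
  have hv : 0 < 1 - cos θ := by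
    have : cos θ < 1 := by
      rw [← cos_zero]
      exact cos_lt_cos_of_nonneg_of_le_pi le_rfl (by linarith [hθ.2, pi_pos]) hθ.1
    linarith
  have hD : 0 < E + 2 * X * (1 - cos θ) := by positivity
  have h1 : HasDerivAt (fun θ => 1 - cos θ) (sin θ) θ := by
    simpa using (hasDerivAt_cos θ).const_sub 1
  have h2 : HasDerivAt (fun θ => E + 2 * X * (1 - cos θ)) (2 * X * sin θ) θ :=
    (h1.const_mul (2 * X)).const_add E
  have h3 := ((h1.div h2 hD.ne').rpow_const (p := lam)
    (Or.inl (div_pos hv hD).ne')).div_const (lam * E)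
  refine h3.congr_deriv ?_
  simp only [Pi.div_apply]
  rw [Real.div_rpow hv.le hD.le, show -(lam + 1) = -(lam - 1) - (2 : ℕ) by push_cast; ring,
    Real.rpow_sub_natCast hD.ne', Real.rpow_neg hD.le]
  field_simp
  ring

theorem continuous_angular_primitive {lam E X : ℝ} (hlam : 0 < lam) (hE : 0 < E) (hX : 0 ≤ X) :
    Continuous (fun θ => ((1 - cos θ) / (E + 2 * X * (1 - cos θ))) ^ lam / (lam * E)) := by
  have hD : ∀ θ, E + 2 * X * (1 - cos θ) ≠ 0 := fun θ => by
    have : 0 ≤ 1 - cos θ := by linarith [cos_le_one θ]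
    positivity
  refine Continuous.div_const (Continuous.rpow_const (Continuous.div ?_ ?_ hD)
    fun _ => Or.inr hlam.le) _ <;> fun_prop

theorem sin_rpow_le {lam θ : ℝ} (hθ : θ ∈ Set.Ioo 0 (π / 2)) (hlam : 0 < lam) :
    sin θ ^ (2 * lam - 1) ≤ 2 ^ lam * (sin θ * (1 - cos θ) ^ (lam - 1)) := by
  have hs : 0 < sin θ := sin_pos_of_pos_of_lt_pi hθ.1 (by linarith [hθ.2, pi_pos])
  have hc : 0 < cos θ := cos_pos_of_mem_Ioo ⟨by linarith [hθ.1, pi_pos], hθ.2⟩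
  have hsq : (1 - cos θ) * (1 + cos θ) = sin θ ^ (2 : ℝ) := by
    rw [Real.rpow_two, sin_sq]; ring
  have hv : 0 < 1 - cos θ := by
    have h2 : 0 < sin θ ^ (2 : ℝ) := by positivity
    rw [← hsq] at h2
    exact pos_of_mul_pos_left h2 (by positivity)
  have e : sin θ ^ (2 * lam - 1) = sin θ * ((1 - cos θ) ^ (lam - 1) * (1 + cos θ) ^ (lam - 1)) := by
    rw [← Real.mul_rpow hv.le (by positivity), hsq, ← Real.rpow_mul hs.le,
      show 2 * lam - 1 = 1 + 2 * (lam - 1) by ring, Real.rpow_add hs, Real.rpow_one]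
  rw [e]
  -- Raising the exponent to λ first, using 1 + cos θ ≥ 1, avoids splitting on the sign of λ - 1.
  have hle : (1 + cos θ) ^ (lam - 1) ≤ 2 ^ lam :=
    calc (1 + cos θ) ^ (lam - 1) ≤ (1 + cos θ) ^ lam :=
          Real.rpow_le_rpow_of_exponent_le (by linarith) (by linarith)
      _ ≤ 2 ^ lam := Real.rpow_le_rpow (by positivity) (by linarith [cos_le_one θ]) hlam.le
  calc sin θ * ((1 - cos θ) ^ (lam - 1) * (1 + cos θ) ^ (lam - 1))
      ≤ sin θ * ((1 - cos θ) ^ (lam - 1) * 2 ^ lam) := by gcongr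
    _ = _ := by ring

/-- A nonnegative derivative of a continuous function is integrable, so the singularity at θ = 0 for
λ < 1/2 needs no separate estimate. -/
theorem intervalIntegrable_angular_deriv {lam E X : ℝ} (hlam : 0 < lam) (hE : 0 < E)
    (hX : 0 ≤ X) :
    IntervalIntegrable (fun θ => sin θ * (1 - cos θ) ^ (lam - 1) *
      (E + 2 * X * (1 - cos θ)) ^ (-(lam + 1))) volume 0 (π / 2) := by
  have hp : (0 : ℝ) ≤ π / 2 := by positivity
  refine intervalIntegral.intervalIntegrable_deriv_of_nonneg
    (continuous_angular_primitive hlam hE hX).continuousOn ?_ ?_ <;>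
    rw [min_eq_left hp, max_eq_right hp]
  · exact fun θ hθ => hasDerivAt_angular_primitive hlam hE hX hθ
  · intro θ hθ
    have hs : 0 < sin θ := sin_pos_of_pos_of_lt_pi hθ.1 (by linarith [hθ.2, pi_pos])
    have : 0 ≤ 1 - cos θ := by linarith [cos_le_one θ]
    positivity

theorem integral_angular_deriv {lam E X : ℝ} (hlam : 0 < lam) (hE : 0 < E) (hX : 0 ≤ X) :
    ∫ θ in (0 : ℝ)..π / 2, sin θ * (1 - cos θ) ^ (lam - 1) *
      (E + 2 * X * (1 - cos θ)) ^ (-(lam + 1)) = E⁻¹ * (E + 2 * X) ^ (-lam) / lam := by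
  have hp : (0 : ℝ) ≤ π / 2 := by positivity
  rw [intervalIntegral.integral_eq_sub_of_hasDerivAt_of_le hp
    (continuous_angular_primitive hlam hE hX).continuousOn
    (fun θ hθ => hasDerivAt_angular_primitive hlam hE hX hθ)
    (intervalIntegrable_angular_deriv hlam hE hX)]
  have : 0 < E + 2 * X := by positivity
  simp only [cos_pi_div_two, cos_zero, sub_zero, sub_self, mul_one, mul_zero, zero_div,
    Real.zero_rpow hlam.ne', add_zero, one_div]
  rw [Real.inv_rpow this.le, Real.rpow_neg this.le]
  field_simp

theorem intervalIntegrable_sin_rpow_mul_half {lam : ℝ} (hlam : 0 < lam) :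
    IntervalIntegrable (fun θ => sin θ ^ (2 * lam - 1)) volume 0 (π / 2) := by
  have hp : (0 : ℝ) ≤ π / 2 := by positivity
  -- The case E = 1, X = 0, in which the denominator is identically 1.
  have h := (intervalIntegrable_angular_deriv hlam one_pos le_rfl).const_mul (2 ^ lam)
  rw [intervalIntegrable_iff_integrableOn_Ioo_of_le hp] at h ⊢
  refine Integrable.mono' h ?_ ?_
  · exact (Measurable.pow_const measurable_sin _).aestronglyMeasurable
  · filter_upwards [ae_restrict_mem measurableSet_Ioo] with θ hθ
    have hs : 0 < sin θ := sin_pos_of_pos_of_lt_pi hθ.1 (by linarith [hθ.2, pi_pos])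
    rw [Real.norm_of_nonneg (by positivity)]
    simpa using sin_rpow_le hθ hlam

theorem integrableOn_sin_rpow {lam : ℝ} (hlam : 0 < lam) :
    IntegrableOn (fun θ => sin θ ^ (2 * lam - 1)) (Set.Ioc 0 π) := by
  have h := intervalIntegrable_sin_rpow_mul_half hlam
  have h2 := (h.comp_sub_left π).symm
  simp only [sin_pi_sub, sub_zero] at h2
  rw [show π - π / 2 = π / 2 by ring] at h2
  exact (intervalIntegrable_iff_integrableOn_Ioc_of_le pi_pos.le).1 (h.trans h2)

theorem sin_rpow_nonneg {s θ : ℝ} (hθ : θ ∈ Set.Ioc 0 π) : 0 ≤ sin θ ^ s :=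
  Real.rpow_nonneg (sin_nonneg_of_nonneg_of_le_pi hθ.1.le hθ.2) _

theorem angular_denominator_pos {E X : ℝ} (hE : 0 < E) (hX : 0 ≤ X) (θ : ℝ) :
    0 < E + 2 * X * (1 - cos θ) := by
  have : 0 ≤ 1 - cos θ := by linarith [cos_le_one θ]
  positivity

theorem integrableOn_angular {lam E X b : ℝ} (hlam : 0 < lam) (hE : 0 < E)
    (hX : 0 ≤ X) :
    IntegrableOn (fun θ => (E + 2 * X * (1 - cos θ)) ^ (-b) * sin θ ^ (2 * lam - 1))
      (Set.Ioc 0 π) := by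
  have hc : Continuous fun θ => (E + 2 * X * (1 - cos θ)) ^ (-b) :=
    Continuous.rpow_const (by fun_prop) fun θ => Or.inl (angular_denominator_pos hE hX θ).ne'
  obtain ⟨M, hM⟩ := isCompact_Icc.exists_bound_of_continuousOn (s := Set.Icc 0 π) hc.continuousOn
  refine Integrable.bdd_mul (c := M) (integrableOn_sin_rpow hlam) hc.aestronglyMeasurable ?_
  filter_upwards [ae_restrict_mem measurableSet_Ioc] with θ hθ
  exact hM θ ⟨hθ.1.le, hθ.2⟩

/-- On [π/2, π] the denominator is larger than at the reflected angle, so this half costs only a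
factor 2. On [0, π/2] the surplus power μ - 1 is bounded through E, and the rest is the explicit
integral with exponent λ + 1. -/
theorem integral_angular_le {lam μ E X : ℝ} (hlam : 0 < lam) (hμ : 1 ≤ μ) (hE : 0 < E)
    (hX : 0 ≤ X) :
    ∫ θ in Set.Ioc 0 π, (E + 2 * X * (1 - cos θ)) ^ (-(lam + μ)) * sin θ ^ (2 * lam - 1) ≤
      2 ^ (lam + 1) / lam * (E ^ (-μ) * (E + 2 * X) ^ (-lam)) := by
  have hp : (0 : ℝ) ≤ π / 2 := by positivity
  have hint := integrableOn_angular (b := lam + μ) hlam hE hX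
  rw [← intervalIntegrable_iff_integrableOn_Ioc_of_le pi_pos.le] at hint
  rw [← intervalIntegral.integral_of_le pi_pos.le]
  set f := fun θ => (E + 2 * X * (1 - cos θ)) ^ (-(lam + μ)) * sin θ ^ (2 * lam - 1) with hf
  have hi1 : IntervalIntegrable f volume 0 (π / 2) :=
    hint.mono_set (by rw [Set.uIcc_of_le hp, Set.uIcc_of_le pi_pos.le]
                      exact Set.Icc_subset_Icc_right (by linarith))
  have hi2 : IntervalIntegrable f volume (π / 2) π :=
    hint.mono_set (by rw [Set.uIcc_of_le (by linarith), Set.uIcc_of_le pi_pos.le]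
                      exact Set.Icc_subset_Icc_left hp)
  have hrefl : ∫ θ in π / 2..π, f θ = ∫ θ in (0 : ℝ)..π / 2, f (π - θ) := by
    rw [intervalIntegral.integral_comp_sub_left, sub_zero, show π - π / 2 = π / 2 by ring]
  have hi3 : IntervalIntegrable (fun θ => f (π - θ)) volume 0 (π / 2) := by
    have := (hi2.comp_sub_left π).symm
    rwa [sub_self, show π - π / 2 = π / 2 by ring] at this
  have hle : ∫ θ in (0 : ℝ)..π / 2, f (π - θ) ≤ ∫ θ in (0 : ℝ)..π / 2, f θ := by
    refine intervalIntegral.integral_mono_on_of_le_Ioo hp hi3 hi1 fun θ hθ => ?_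
    have hs : 0 < sin θ := sin_pos_of_pos_of_lt_pi hθ.1 (by linarith [hθ.2, pi_pos])
    have hc : 0 < cos θ := cos_pos_of_mem_Ioo ⟨by linarith [hθ.1, pi_pos], hθ.2⟩
    simp only [hf, sin_pi_sub, cos_pi_sub]
    refine mul_le_mul_of_nonneg_right ?_ (by positivity)
    refine Real.rpow_le_rpow_of_nonpos (angular_denominator_pos hE hX θ) ?_ (by linarith)
    have : X * (1 - cos θ) ≤ X * (1 - -cos θ) := mul_le_mul_of_nonneg_left (by linarith) hX
    linarith
  have hmain : ∫ θ in (0 : ℝ)..π / 2, f θ ≤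
      ∫ θ in (0 : ℝ)..π / 2, 2 ^ lam * E ^ (1 - μ) * (sin θ * (1 - cos θ) ^ (lam - 1) *
      (E + 2 * X * (1 - cos θ)) ^ (-(lam + 1))) := by
    refine intervalIntegral.integral_mono_on_of_le_Ioo hp hi1
      ((intervalIntegrable_angular_deriv hlam hE hX).const_mul _) fun θ hθ => ?_
    have hD := angular_denominator_pos hE hX θ
    have hs : 0 < sin θ := sin_pos_of_pos_of_lt_pi hθ.1 (by linarith [hθ.2, pi_pos])
    have hv : 0 ≤ 1 - cos θ := by linarith [cos_le_one θ]
    have h1 : (E + 2 * X * (1 - cos θ)) ^ (-(lam + μ)) ≤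
        E ^ (1 - μ) * (E + 2 * X * (1 - cos θ)) ^ (-(lam + 1)) := by
      rw [show -(lam + μ) = (1 - μ) + -(lam + 1) by ring, Real.rpow_add hD]
      refine mul_le_mul_of_nonneg_right ?_ (by positivity)
      refine Real.rpow_le_rpow_of_nonpos hE ?_ (by linarith)
      nlinarith [mul_nonneg hX hv]
    calc f θ ≤ (E ^ (1 - μ) * (E + 2 * X * (1 - cos θ)) ^ (-(lam + 1))) *
          (2 ^ lam * (sin θ * (1 - cos θ) ^ (lam - 1))) := by
          refine mul_le_mul h1 (sin_rpow_le hθ hlam) (by positivity) (by positivity)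
      _ = _ := by ring
  rw [intervalIntegral.integral_const_mul, integral_angular_deriv hlam hE hX] at hmain
  rw [← intervalIntegral.integral_add_adjacent_intervals hi1 hi2, hrefl]
  have e : 2 ^ (lam + 1) / lam * (E ^ (-μ) * (E + 2 * X) ^ (-lam)) =
      2 * (2 ^ lam * E ^ (1 - μ) * (E⁻¹ * (E + 2 * X) ^ (-lam) / lam)) := by
    rw [Real.rpow_add_one two_ne_zero, show 1 - μ = -μ + 1 by ring, Real.rpow_add_one hE.ne']
    field_simp
  rw [e]
  linarith

/-! ### Differentiation of double integrals and cancellation -/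

theorem integrable_prod_of_bound {g : ℝ → ℝ} {J : Set ℝ} (hg : IntegrableOn g J)
    {w : ℝ → ℂ} (hw : Integrable w) {S : Set ℝ} (hwS : Function.support w ⊆ S)
    {K : ℝ × ℝ → ℝ} (hK : Measurable K) {B : ℝ} (hB : ∀ z : ℝ × ℝ, z.1 ∈ S → |K z| ≤ B) :
    Integrable (fun z : ℝ × ℝ => (K z * g z.2) • w z.1)
      (volume.prod (volume.restrict J)) := by
  have h1 : Integrable (fun z : ℝ × ℝ => (w z.1) * ((g z.2 : ℝ) : ℂ))
      (volume.prod (volume.restrict J)) := hw.mul_prod hg.ofReal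
  have hm : AEStronglyMeasurable (fun z : ℝ × ℝ => (K z * g z.2) • w z.1)
      (volume.prod (volume.restrict J)) := by
    have e : (fun z : ℝ × ℝ => (K z * g z.2) • w z.1) =
        fun z : ℝ × ℝ => K z • ((w z.1) * ((g z.2 : ℝ) : ℂ)) := by
      ext z; rw [mul_smul, Complex.real_smul, Complex.real_smul, Complex.real_smul]; ring
    rw [e]
    exact hK.aestronglyMeasurable.smul h1.aestronglyMeasurable
  refine Integrable.mono' (h1.norm.const_mul B) hm (Filter.Eventually.of_forall fun z => ?_)
  by_cases hz : z.1 ∈ S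
  · rw [norm_smul, norm_mul, norm_mul, Complex.norm_real, Real.norm_eq_abs]
    calc |K z| * ‖g z.2‖ * ‖w z.1‖ ≤ B * ‖g z.2‖ * ‖w z.1‖ := by
          gcongr; exact hB z hz
      _ = _ := by ring
  · have : w z.1 = 0 := by
      by_contra h
      exact hz (hwS h)
    simp [this]

/-- The derivative is left as an integral over the product measure so that either order of
integration stays available: θ first for size estimates, t first for cancellation. -/
theorem hasDerivAt_integral_prod {g : ℝ → ℝ} (hg : IntegrableOn g (Set.Ioc 0 π))
    {w : ℝ → ℂ} (hw : Integrable w) {S : Set ℝ} (hwS : Function.support w ⊆ S)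
    {k k' : ℝ → ℝ × ℝ → ℝ} {y ε B : ℝ} (hε : 0 < ε)
    (hk : ∀ s ∈ Metric.ball y ε, Measurable (k s)) (hk' : Measurable (k' y))
    (hkB : ∀ s ∈ Metric.ball y ε, ∀ z : ℝ × ℝ, z.1 ∈ S → |k s z| ≤ B)
    (hkB' : ∀ s ∈ Metric.ball y ε, ∀ z : ℝ × ℝ, z.1 ∈ S → |k' s z| ≤ B)
    (hd : ∀ s ∈ Metric.ball y ε, ∀ z : ℝ × ℝ, HasDerivAt (fun s => k s z) (k' s z) s) :
    HasDerivAt (fun s => ∫ t, (∫ θ in (0 : ℝ)..π, k s (t, θ) * g θ) • w t)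
      (∫ z : ℝ × ℝ, (k' y z * g z.2) • w z.1 ∂(volume.prod (volume.restrict (Set.Ioc 0 π)))) y := by
  have hball : Metric.ball y ε ∈ nhds y := Metric.ball_mem_nhds _ hε
  have hI : ∀ s ∈ Metric.ball y ε, Integrable (fun z : ℝ × ℝ => (k s z * g z.2) • w z.1)
      (volume.prod (volume.restrict (Set.Ioc 0 π))) := fun s hs =>
    integrable_prod_of_bound hg hw hwS (hk s hs) (hkB s hs)
  have hI' : Integrable (fun z : ℝ × ℝ => (k' y z * g z.2) • w z.1)
      (volume.prod (volume.restrict (Set.Ioc 0 π))) :=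
    integrable_prod_of_bound hg hw hwS hk' (hkB' y (Metric.mem_ball_self hε))
  have hb : Integrable (fun z : ℝ × ℝ => B * ‖w z.1 * ((g z.2 : ℝ) : ℂ)‖)
      (volume.prod (volume.restrict (Set.Ioc 0 π))) :=
    ((hw.mul_prod hg.ofReal).norm).const_mul B
  have h := (hasDerivAt_integral_of_dominated_loc_of_deriv_le (𝕜 := ℝ)
    (F := fun s (z : ℝ × ℝ) => (k s z * g z.2) • w z.1)
    (F' := fun s (z : ℝ × ℝ) => (k' s z * g z.2) • w z.1) hball
    (Filter.eventually_of_mem hball fun s hs => (hI s hs).aestronglyMeasurable)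
    (hI y (Metric.mem_ball_self hε)) hI'.aestronglyMeasurable
    (Filter.Eventually.of_forall fun z s hs => ?_) hb
    (Filter.Eventually.of_forall fun z s hs => ?_)).2
  · refine h.congr_of_eventuallyEq (Filter.eventually_of_mem hball fun s hs => ?_)
    simp only
    rw [integral_prod _ (hI s hs)]
    refine integral_congr_ae (Filter.Eventually.of_forall fun t => ?_)
    simp only
    rw [integral_smul_const, intervalIntegral.integral_of_le pi_pos.le]
  · by_cases hz : z.1 ∈ S
    · rw [norm_smul, norm_mul, norm_mul, Complex.norm_real, Real.norm_eq_abs]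
      calc |k' s z| * ‖g z.2‖ * ‖w z.1‖ ≤ B * ‖g z.2‖ * ‖w z.1‖ := by
            gcongr; exact hkB' s hs z hz
        _ = _ := by ring
    · have : w z.1 = 0 := by
        by_contra h
        exact hz (hwS h)
      simp [this]
  · exact ((hd s hs z).mul_const _).smul_const _

theorem integral_polynomial_smul_eq_zero {w : ℝ → ℂ} (hw : Integrable w) {x₀ δ : ℝ}
    (hwS : Function.support w ⊆ Metric.ball x₀ δ) {κ : ℕ}
    (hmom : ∀ k ≤ κ, ∫ t : ℝ, t ^ k • w t = 0) {q : Polynomial ℝ} (hq : q.natDegree ≤ κ) :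
    Integrable (fun t => q.eval t • w t) ∧ ∫ t, q.eval t • w t = 0 := by
  have hpow : ∀ k : ℕ, Integrable fun t => t ^ k • w t := by
    intro k
    refine Integrable.mono' (hw.norm.const_mul ((|x₀| + δ) ^ k))
      ((by fun_prop : Continuous fun t : ℝ => t ^ k).aestronglyMeasurable.smul
        hw.aestronglyMeasurable) (Filter.Eventually.of_forall fun t => ?_)
    by_cases ht : w t = 0
    · simp [ht]
    · have h1 : |t - x₀| < δ := by simpa [Real.dist_eq] using hwS ht
      have h2 : |t| ≤ |x₀| + δ := by
        calc |t| = |x₀ + (t - x₀)| := by congr 1; ring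
          _ ≤ |x₀| + |t - x₀| := abs_add_le _ _
          _ ≤ _ := by linarith
      rw [norm_smul, norm_pow, Real.norm_eq_abs]
      gcongr
  have e : (fun t => q.eval t • w t) =
      fun t => ∑ i ∈ Finset.range (q.natDegree + 1), q.coeff i • (t ^ i • w t) := by
    ext t
    rw [Polynomial.eval_eq_sum_range, Finset.sum_smul]
    simp [mul_smul]
  have hsm : ∀ i ∈ Finset.range (q.natDegree + 1),
      Integrable fun t => q.coeff i • (t ^ i • w t) := fun i _ => (hpow i).smul (q.coeff i)
  rw [e]
  refine ⟨integrable_finsetSum _ hsm, ?_⟩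
  rw [integral_finsetSum _ hsm]
  refine Finset.sum_eq_zero fun i hi => ?_
  rw [integral_smul, hmom i (by have := Finset.mem_range.1 hi; omega), smul_zero]

theorem norm_integral_smul_le_of_approx {w : ℝ → ℂ} (hw : Integrable w) {x₀ δ : ℝ}
    (hwS : Function.support w ⊆ Metric.ball x₀ δ) {κ : ℕ}
    (hmom : ∀ k ≤ κ, ∫ t : ℝ, t ^ k • w t = 0) {f : ℝ → ℝ} (hf : Measurable f) {q : Polynomial ℝ}
    (hq : q.natDegree ≤ κ) {B : ℝ} (hB : ∀ t ∈ Metric.ball x₀ δ, |f t - q.eval t| ≤ B) :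
    ‖∫ t, f t • w t‖ ≤ B * ∫ t, ‖w t‖ := by
  obtain ⟨hqi, hq0⟩ := integral_polynomial_smul_eq_zero hw hwS hmom hq
  have hbd : ∀ t, ‖(f t - q.eval t) • w t‖ ≤ B * ‖w t‖ := by
    intro t
    by_cases ht : w t = 0
    · simp [ht]
    · rw [norm_smul, Real.norm_eq_abs]
      gcongr
      exact hB t (hwS ht)
  have hdi : Integrable fun t => (f t - q.eval t) • w t :=
    Integrable.mono' (hw.norm.const_mul B)
      ((hf.sub q.continuous.measurable).aestronglyMeasurable.smul hw.aestronglyMeasurable)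
      (Filter.Eventually.of_forall hbd)
  have e : ∫ t, f t • w t = ∫ t, (f t - q.eval t) • w t := by
    have h := integral_add hdi hqi
    rw [hq0, add_zero] at h
    rw [← h]
    refine integral_congr_ae (Filter.Eventually.of_forall fun t => ?_)
    simp only
    rw [← add_smul, sub_add_cancel]
  rw [e, ← integral_const_mul]
  exact norm_integral_le_of_norm_le (hw.norm.const_mul B) (Filter.Eventually.of_forall hbd)

/-- The approximating polynomial may depend on θ with no regularity, since it is removed by the
moments in the inner t-integral at fixed θ. -/
theorem norm_integral_prod_le_of_cancellation {g : ℝ → ℝ} {J : Set ℝ} (hJ : MeasurableSet J)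
    (hg : IntegrableOn g J) (hg0 : ∀ θ ∈ J, 0 ≤ g θ)
    {w : ℝ → ℂ} (hw : Integrable w) {x₀ δ : ℝ}
    (hwS : Function.support w ⊆ Metric.ball x₀ δ) {κ : ℕ}
    (hmom : ∀ k ≤ κ, ∫ t : ℝ, t ^ k • w t = 0) {K : ℝ × ℝ → ℝ} (hK : Measurable K) {B : ℝ}
    (hB : ∀ z : ℝ × ℝ, z.1 ∈ Metric.ball x₀ δ → |K z| ≤ B) {b : ℝ → ℝ}
    (hb : IntegrableOn (fun θ => b θ * g θ) J)
    (hq : ∀ θ, ∃ q : Polynomial ℝ, q.natDegree ≤ κ ∧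
      ∀ t ∈ Metric.ball x₀ δ, |K (t, θ) - q.eval t| ≤ b θ) :
    ‖∫ z : ℝ × ℝ, (K z * g z.2) • w z.1 ∂(volume.prod (volume.restrict J))‖ ≤
      (∫ θ in J, b θ * g θ) * ∫ t, ‖w t‖ := by
  rw [integral_prod_symm _ (integrable_prod_of_bound hg hw hwS hK hB), ← integral_mul_const]
  refine norm_integral_le_of_norm_le (Integrable.mul_const hb _) ?_
  filter_upwards [ae_restrict_mem hJ] with θ hθ
  obtain ⟨q, hqd, hqB⟩ := hq θ
  have h := norm_integral_smul_le_of_approx hw hwS hmom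
    (f := fun t => K (t, θ)) (hK.comp measurable_prodMk_right) hqd hqB
  have e : ∫ t, (K (t, θ) * g θ) • w t = g θ • ∫ t, K (t, θ) • w t := by
    rw [← integral_smul]
    refine integral_congr_ae (Filter.Eventually.of_forall fun t => ?_)
    simp only
    rw [mul_comm, mul_smul]
  rw [e, norm_smul, Real.norm_of_nonneg (hg0 θ hθ)]
  calc g θ * ‖∫ t, K (t, θ) • w t‖ ≤ g θ * (b θ * ∫ t, ‖w t‖) :=
        mul_le_mul_of_nonneg_left h (hg0 θ hθ)
    _ = _ := by ring

theorem norm_integral_prod_le_of_size {g : ℝ → ℝ} {J : Set ℝ} (hJ : MeasurableSet J)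
    (hg : IntegrableOn g J) (hg0 : ∀ θ ∈ J, 0 ≤ g θ)
    {w : ℝ → ℂ} (hw : Integrable w) {S : Set ℝ} (hwS : Function.support w ⊆ S)
    {K : ℝ × ℝ → ℝ} (hK : Measurable K) {B : ℝ} (hB : ∀ z : ℝ × ℝ, z.1 ∈ S → |K z| ≤ B)
    {b : ℝ → ℝ → ℝ} (hb : ∀ t ∈ S, IntegrableOn (fun θ => b t θ * g θ) J)
    (hKb : ∀ t ∈ S, ∀ θ, |K (t, θ)| ≤ b t θ)
    {h : ℝ → ℝ} (hh : Integrable h) (hh0 : ∀ t, 0 ≤ h t)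
    (hbh : ∀ᵐ t, t ∈ S → (∫ θ in J, b t θ * g θ) * ‖w t‖ ≤ h t) :
    ‖∫ z : ℝ × ℝ, (K z * g z.2) • w z.1 ∂(volume.prod (volume.restrict J))‖ ≤ ∫ t, h t := by
  rw [integral_prod _ (integrable_prod_of_bound hg hw hwS hK hB)]
  refine norm_integral_le_of_norm_le hh ?_
  filter_upwards [hbh] with t ht
  by_cases hwt : w t = 0
  · simpa [hwt] using hh0 t
  · have htS := hwS hwt
    refine le_trans ?_ (ht htS)
    rw [integral_smul_const, norm_smul]
    gcongr
    refine norm_integral_le_of_norm_le (hb t htS) ?_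
    filter_upwards [ae_restrict_mem hJ] with θ hθ
    rw [norm_mul, Real.norm_of_nonneg (hg0 θ hθ), Real.norm_eq_abs]
    exact mul_le_mul_of_nonneg_right (hKb t htS θ) (hg0 θ hθ)

noncomputable section

/-! ### The kernels before angular integration -/

/-- The quadratic form in the denominator of the Poisson kernels. -/
def quad (x y t θ : ℝ) : ℝ := y ^ 2 + x ^ 2 + t ^ 2 - 2 * |x * t| * cos θ

/-- The part of `quad` that does not depend on the angle. -/
def radialPart (x y t : ℝ) : ℝ := y ^ 2 + (|x| - |t|) ^ 2

/-- The integrand of the Poisson kernel, with the sign of `x t` replaced by `σ`. -/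
def poissonIntegrand (lam x σ y : ℝ) (z : ℝ × ℝ) : ℝ :=
  y * (1 + σ * cos z.2) / quad x y z.1 z.2 ^ (lam + 1)

/-- The derivative in `y` of `poissonIntegrand`. -/
def poissonIntegrandDeriv (lam x σ y : ℝ) (z : ℝ × ℝ) : ℝ :=
  (1 + σ * cos z.2) * (quad x y z.1 z.2 ^ (-(lam + 1)) -
    2 * (lam + 1) * y ^ 2 * quad x y z.1 z.2 ^ (-(lam + 2)))

/-- The integrand of the conjugate Poisson kernel, with the sign of `x t` replaced by `σ`. -/
def conjIntegrand (lam x σ y : ℝ) (z : ℝ × ℝ) : ℝ :=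
  (x - z.1) * (1 + σ * cos z.2) / quad x y z.1 z.2 ^ (lam + 1)

/-- The derivative in `y` of `conjIntegrand`. -/
def conjIntegrandDeriv (lam x σ y : ℝ) (z : ℝ × ℝ) : ℝ :=
  -(2 * (lam + 1)) * y * ((x - z.1) * (1 + σ * cos z.2)) * quad x y z.1 z.2 ^ (-(lam + 2))

theorem quad_eq (x y t θ : ℝ) :
    quad x y t θ = radialPart x y t + 2 * |x * t| * (1 - cos θ) := by
  rw [quad, radialPart, abs_mul]
  linear_combination -(sq_abs x) - sq_abs t

theorem radialPart_add (x y t : ℝ) : radialPart x y t + 2 * |x * t| = y ^ 2 + x ^ 2 + t ^ 2 := by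
  rw [radialPart, abs_mul]
  linear_combination sq_abs x + sq_abs t

theorem radialPart_le_quad (x y t θ : ℝ) : radialPart x y t ≤ quad x y t θ := by
  rw [quad_eq]
  have : 0 ≤ 1 - cos θ := by linarith [cos_le_one θ]
  have : 0 ≤ 2 * |x * t| * (1 - cos θ) := by positivity
  linarith

theorem sq_le_quad (x y t θ : ℝ) : y ^ 2 ≤ quad x y t θ := by
  have := radialPart_le_quad x y t θ
  rw [radialPart] at this
  nlinarith [sq_nonneg (|x| - |t|)]

theorem quad_pos {y : ℝ} (hy : 0 < y) (x t θ : ℝ) : 0 < quad x y t θ :=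
  (pow_pos hy 2).trans_le (sq_le_quad x y t θ)

theorem le_sqrt_quad {y : ℝ} (x t θ : ℝ) : y ≤ √(quad x y t θ) :=
  Real.le_sqrt_of_sq_le (sq_le_quad x y t θ)

theorem abs_one_add_mul_cos_le {σ : ℝ} (hσ : |σ| ≤ 1) (θ : ℝ) : |1 + σ * cos θ| ≤ 2 := by
  refine (abs_add_le _ _).trans ?_
  rw [abs_one, abs_mul]
  nlinarith [abs_cos_le_one θ, abs_nonneg (cos θ), abs_nonneg σ]

theorem abs_sign_le_one (r : ℝ) : |Real.sign r| ≤ 1 := by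
  rcases Real.sign_apply_eq r with h | h | h <;> rw [h] <;> norm_num

/-- For xt > 0 the quadratic dominates (x - t)². For xt < 0 it equals y² + (1 + cos θ)(x + t)²/2 +
(1 - cos θ)(x - t)²/2, and the factor 1 - cos θ in the kernel compensates exactly for the loss where
x - t is large. -/
theorem abs_sub_mul_le_sqrt_quad (x y t θ : ℝ) :
    |(x - t) * (1 + Real.sign (x * t) * cos θ)| ≤ 2 * √(quad x y t θ) := by
  rw [show (2 : ℝ) * √(quad x y t θ) = √(4 * quad x y t θ) by
    rw [Real.sqrt_mul (by norm_num), show (4 : ℝ) = 2 ^ 2 by norm_num, Real.sqrt_sq (by norm_num)]]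
  refine Real.abs_le_sqrt ?_
  have hc := cos_le_one θ
  have hc' := neg_one_le_cos θ
  rcases lt_trichotomy (x * t) 0 with h | h | h
  · rw [Real.sign_of_neg h, quad, abs_of_neg h]
    have h1 : (1 - cos θ) ^ 2 ≤ 2 * (1 - cos θ) := by nlinarith
    nlinarith [mul_le_mul_of_nonneg_left h1 (sq_nonneg (x - t)), sq_nonneg y,
      mul_nonneg (sq_nonneg (x + t)) (by linarith : 0 ≤ 1 + cos θ), sq_nonneg (x + t)]
  · rw [h, quad, h]
    simp
    nlinarith [sq_nonneg y, sq_nonneg x, sq_nonneg t]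
  · rw [Real.sign_of_pos h, quad, abs_of_pos h]
    have h1 : (1 + cos θ) ^ 2 ≤ 4 := by nlinarith
    nlinarith [mul_le_mul_of_nonneg_left h1 (sq_nonneg (x - t)), sq_nonneg y,
      mul_nonneg h.le (by linarith : 0 ≤ 1 - cos θ)]

theorem continuous_quad (x y : ℝ) : Continuous fun z : ℝ × ℝ => quad x y z.1 z.2 := by
  unfold quad; fun_prop

theorem measurable_quad_rpow (x y s : ℝ) :
    Measurable fun z : ℝ × ℝ => quad x y z.1 z.2 ^ s :=
  (continuous_quad x y).measurable.pow_const s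

theorem measurable_poissonIntegrand (lam x σ y : ℝ) : Measurable (poissonIntegrand lam x σ y) := by
  unfold poissonIntegrand
  exact (by fun_prop : Continuous fun z : ℝ × ℝ => y * (1 + σ * cos z.2)).measurable.div
    (measurable_quad_rpow x y _)

theorem measurable_conjIntegrand (lam x σ y : ℝ) : Measurable (conjIntegrand lam x σ y) := by
  unfold conjIntegrand
  exact (by fun_prop : Continuous fun z : ℝ × ℝ => (x - z.1) * (1 + σ * cos z.2)).measurable.div
    (measurable_quad_rpow x y _)

theorem measurable_poissonIntegrandDeriv (lam x σ y : ℝ) :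
    Measurable (poissonIntegrandDeriv lam x σ y) := by
  unfold poissonIntegrandDeriv
  exact (by fun_prop : Continuous fun z : ℝ × ℝ => 1 + σ * cos z.2).measurable.mul
    ((measurable_quad_rpow x y _).sub ((measurable_quad_rpow x y _).const_mul _))

theorem measurable_conjIntegrandDeriv (lam x σ y : ℝ) :
    Measurable (conjIntegrandDeriv lam x σ y) := by
  unfold conjIntegrandDeriv
  exact (by fun_prop : Continuous fun z : ℝ × ℝ =>
    -(2 * (lam + 1)) * y * ((x - z.1) * (1 + σ * cos z.2))).measurable.mul
    (measurable_quad_rpow x y _)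

theorem hasDerivAt_quad_rpow {y : ℝ} (hy : 0 < y) (x t θ s : ℝ) :
    HasDerivAt (fun y => quad x y t θ ^ s) (2 * y * s * quad x y t θ ^ (s - 1)) y := by
  have h : HasDerivAt (fun y => quad x y t θ) (2 * y) y := by
    unfold quad
    simpa using (((hasDerivAt_pow 2 y).add_const (x ^ 2)).add_const (t ^ 2)).sub_const
      (2 * |x * t| * cos θ)
  exact h.rpow_const (Or.inl (quad_pos hy x t θ).ne')

theorem poissonIntegrand_eq {y : ℝ} (hy : 0 < y) (lam x σ : ℝ) (z : ℝ × ℝ) :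
    poissonIntegrand lam x σ y z =
      y * (1 + σ * cos z.2) * quad x y z.1 z.2 ^ (-(lam + 1)) := by
  rw [poissonIntegrand, Real.rpow_neg (quad_pos hy _ _ _).le, div_eq_mul_inv]

theorem conjIntegrand_eq {y : ℝ} (hy : 0 < y) (lam x σ : ℝ) (z : ℝ × ℝ) :
    conjIntegrand lam x σ y z =
      (x - z.1) * (1 + σ * cos z.2) * quad x y z.1 z.2 ^ (-(lam + 1)) := by
  rw [conjIntegrand, Real.rpow_neg (quad_pos hy _ _ _).le, div_eq_mul_inv]

theorem hasDerivAt_poissonIntegrand {y : ℝ} (hy : 0 < y) (lam x σ : ℝ) (z : ℝ × ℝ) :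
    HasDerivAt (fun y => poissonIntegrand lam x σ y z) (poissonIntegrandDeriv lam x σ y z) y := by
  have h := ((hasDerivAt_id y).mul_const (1 + σ * cos z.2)).mul
    (hasDerivAt_quad_rpow hy x z.1 z.2 (-(lam + 1)))
  have h' := h.congr_of_eventuallyEq (f₁ := fun y => poissonIntegrand lam x σ y z)
    (Filter.eventually_of_mem (Ioi_mem_nhds hy) fun s hs => poissonIntegrand_eq hs lam x σ z)
  refine h'.congr_deriv ?_
  rw [poissonIntegrandDeriv, show -(lam + 1) - 1 = -(lam + 2) by ring, id]
  ring

theorem hasDerivAt_conjIntegrand {y : ℝ} (hy : 0 < y) (lam x σ : ℝ) (z : ℝ × ℝ) :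
    HasDerivAt (fun y => conjIntegrand lam x σ y z) (conjIntegrandDeriv lam x σ y z) y := by
  have h := (hasDerivAt_quad_rpow hy x z.1 z.2 (-(lam + 1))).const_mul
    ((x - z.1) * (1 + σ * cos z.2))
  have h' := h.congr_of_eventuallyEq (f₁ := fun y => conjIntegrand lam x σ y z)
    (Filter.eventually_of_mem (Ioi_mem_nhds hy) fun s hs => conjIntegrand_eq hs lam x σ z)
  refine h'.congr_deriv ?_
  rw [conjIntegrandDeriv, show -(lam + 1) - 1 = -(lam + 2) by ring]
  ring

theorem quad_rpow_mul_sq_le {y : ℝ} (hy : 0 < y) (lam x t θ : ℝ) :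
    y ^ 2 * quad x y t θ ^ (-(lam + 2)) ≤ quad x y t θ ^ (-(lam + 1)) := by
  have hD := quad_pos hy x t θ
  rw [show -(lam + 1) = 1 + -(lam + 2) by ring, Real.rpow_add hD, Real.rpow_one]
  gcongr
  exact sq_le_quad x y t θ

theorem quad_rpow_mul_sqrt_le {y : ℝ} (hy : 0 < y) (lam x t θ : ℝ) :
    y * √(quad x y t θ) * quad x y t θ ^ (-(lam + 2)) ≤ quad x y t θ ^ (-(lam + 1)) := by
  have hD := quad_pos hy x t θ
  rw [show -(lam + 1) = 1 + -(lam + 2) by ring, Real.rpow_add hD, Real.rpow_one]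
  gcongr
  calc y * √(quad x y t θ) ≤ √(quad x y t θ) * √(quad x y t θ) := by
        gcongr; exact le_sqrt_quad x t θ
    _ = _ := Real.mul_self_sqrt hD.le

theorem abs_poissonIntegrandDeriv_le {lam x σ y : ℝ} (hlam : 0 < lam) (hy : 0 < y) (hσ : |σ| ≤ 1)
    (z : ℝ × ℝ) :
    |poissonIntegrandDeriv lam x σ y z| ≤
      (4 * lam + 6) * quad x y z.1 z.2 ^ (-(lam + 1)) := by
  have hD := quad_pos hy x z.1 z.2
  have h1 := quad_rpow_mul_sq_le hy lam x z.1 z.2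
  have h2 : 0 < quad x y z.1 z.2 ^ (-(lam + 1)) := by positivity
  have h3 : 0 < y ^ 2 * quad x y z.1 z.2 ^ (-(lam + 2)) := by positivity
  rw [poissonIntegrandDeriv, abs_mul]
  have h4 : |quad x y z.1 z.2 ^ (-(lam + 1)) -
      2 * (lam + 1) * y ^ 2 * quad x y z.1 z.2 ^ (-(lam + 2))| ≤
      (2 * lam + 3) * quad x y z.1 z.2 ^ (-(lam + 1)) := by
    rw [abs_le]
    constructor <;> nlinarith
  calc _ ≤ 2 * ((2 * lam + 3) * quad x y z.1 z.2 ^ (-(lam + 1))) := by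
        gcongr; exact abs_one_add_mul_cos_le hσ _
    _ = _ := by ring

theorem abs_conjIntegrandDeriv_le {lam x y : ℝ} (hlam : 0 < lam) (hy : 0 < y) (z : ℝ × ℝ) :
    |conjIntegrandDeriv lam x (Real.sign (x * z.1)) y z| ≤
      (4 * lam + 6) * quad x y z.1 z.2 ^ (-(lam + 1)) := by
  have hD := quad_pos hy x z.1 z.2
  have h1 := quad_rpow_mul_sqrt_le hy lam x z.1 z.2
  have h2 : 0 < quad x y z.1 z.2 ^ (-(lam + 1)) := by positivity
  rw [conjIntegrandDeriv, abs_mul, abs_mul _ ((x - z.1) * _), abs_mul (-(2 * (lam + 1))) y, abs_neg,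
    abs_of_pos (by positivity : 0 < 2 * (lam + 1)), abs_of_pos hy,
    abs_of_pos (by positivity : 0 < quad x y z.1 z.2 ^ (-(lam + 2)))]
  calc _ ≤ 2 * (lam + 1) * y * (2 * √(quad x y z.1 z.2)) * quad x y z.1 z.2 ^ (-(lam + 2)) := by
        gcongr; exact abs_sub_mul_le_sqrt_quad _ _ _ _
    _ = 4 * (lam + 1) * (y * √(quad x y z.1 z.2) * quad x y z.1 z.2 ^ (-(lam + 2))) := by ring
    _ ≤ 4 * (lam + 1) * quad x y z.1 z.2 ^ (-(lam + 1)) := by gcongr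
    -- The constant 4λ + 4 is rounded up so that both kernels share the same one.
    _ ≤ _ := by nlinarith

/-- Serves only for domination and integrability; B may depend on everything and never enters the
final constant. For |s - y| < y/2 the quadratic is at least (y/2)². -/
theorem exists_bound_integrands {lam x σ y x₀ δ : ℝ} (hlam : 0 < lam) (hy : 0 < y) (hσ : |σ| ≤ 1) :
    ∃ B : ℝ, ∀ s ∈ Metric.ball y (y / 2), ∀ z : ℝ × ℝ, z.1 ∈ Metric.ball x₀ δ →
      |poissonIntegrand lam x σ s z| ≤ B ∧ |poissonIntegrandDeriv lam x σ s z| ≤ B ∧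
      |conjIntegrand lam x σ s z| ≤ B ∧ |conjIntegrandDeriv lam x σ s z| ≤ B := by
  set m := ((y / 2) ^ 2) ^ (-(lam + 1)) with hm
  set m' := ((y / 2) ^ 2) ^ (-(lam + 2)) with hm'
  set L := |x| + |x₀| + δ with hL
  have hm0 : 0 < m := by positivity
  have hm'0 : 0 < m' := by positivity
  refine ⟨max (max (2 * y * 2 * m) ((4 * lam + 6) * m))
    (max (L * 2 * m) (2 * (lam + 1) * (2 * y) * (L * 2) * m')), fun s hs z hz => ?_⟩
  rw [Metric.mem_ball, Real.dist_eq, abs_lt] at hs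
  have hs0 : 0 < s := by linarith
  have hsy : s ≤ 2 * y := by linarith
  have hle : (y / 2) ^ 2 ≤ quad x s z.1 z.2 :=
    le_trans (by nlinarith) (sq_le_quad x s z.1 z.2)
  have hD := quad_pos hs0 x z.1 z.2
  have h1 : quad x s z.1 z.2 ^ (-(lam + 1)) ≤ m :=
    Real.rpow_le_rpow_of_nonpos (by positivity) hle (by linarith)
  have h2 : quad x s z.1 z.2 ^ (-(lam + 2)) ≤ m' :=
    Real.rpow_le_rpow_of_nonpos (by positivity) hle (by linarith)
  have p1 : 0 < quad x s z.1 z.2 ^ (-(lam + 1)) := by positivity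
  have p2 : 0 < quad x s z.1 z.2 ^ (-(lam + 2)) := by positivity
  have hc := abs_one_add_mul_cos_le hσ z.2
  have hx : |x - z.1| ≤ L := by
    rw [Metric.mem_ball, Real.dist_eq] at hz
    calc |x - z.1| = |x - x₀ - (z.1 - x₀)| := by congr 1; ring
      _ ≤ |x - x₀| + |z.1 - x₀| := abs_sub _ _
      _ ≤ |x| + |x₀| + |z.1 - x₀| := by gcongr; exact abs_sub _ _
      _ ≤ L := by rw [hL]; linarith
  have hL0 : 0 ≤ L := (abs_nonneg _).trans hx
  refine ⟨?_, ?_, ?_, ?_⟩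
  · refine le_trans ?_ (le_max_of_le_left (le_max_left _ _))
    rw [poissonIntegrand_eq hs0, abs_mul, abs_mul, abs_of_pos hs0, abs_of_pos p1]
    gcongr
  · refine le_trans ?_ (le_max_of_le_left (le_max_right _ _))
    refine (abs_poissonIntegrandDeriv_le hlam hs0 hσ z).trans ?_
    gcongr
  · refine le_trans ?_ (le_max_of_le_right (le_max_left _ _))
    rw [conjIntegrand_eq hs0, abs_mul, abs_mul, abs_of_pos p1]
    gcongr
  · refine le_trans ?_ (le_max_of_le_right (le_max_right _ _))
    rw [conjIntegrandDeriv, abs_mul, abs_mul _ ((x - z.1) * _), abs_mul (-(2 * (lam + 1))) s,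
      abs_neg, abs_of_pos (by positivity : 0 < 2 * (lam + 1)), abs_of_pos hs0, abs_mul,
      abs_of_pos p2]
    gcongr

end

/-! ### Smoothness of the kernels away from the diagonals -/

theorem mul_pos_of_mem_ball {x₀ δ t : ℝ} (hδ : δ < |x₀ / 2|) (ht : t ∈ Metric.ball x₀ δ) :
    0 < t * x₀ := by
  rw [Metric.mem_ball, Real.dist_eq] at ht
  have h := ht.trans hδ
  rw [abs_div, abs_two] at h
  have h0 : 0 < |x₀| := by linarith [abs_nonneg (t - x₀)]
  have h1 : (t - x₀) ^ 2 < (|x₀|) ^ 2 := by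
    rw [← sq_abs (t - x₀)]
    exact pow_lt_pow_left₀ (by linarith) (abs_nonneg _) two_ne_zero
  rw [sq_abs] at h1
  nlinarith [sq_nonneg t]

theorem sign_mul_eq_of_mem_ball {x₀ δ t : ℝ} (hδ : δ < |x₀ / 2|) (ht : t ∈ Metric.ball x₀ δ)
    (x : ℝ) : Real.sign (x * t) = Real.sign (x * x₀) := by
  have h := mul_pos_of_mem_ball hδ ht
  rcases pos_and_pos_or_neg_and_neg_of_mul_pos h with ⟨h1, h2⟩ | ⟨h1, h2⟩ <;>
    rcases lt_trichotomy x 0 with hx | rfl | hx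
  · rw [Real.sign_of_neg (mul_neg_of_neg_of_pos hx h1), Real.sign_of_neg (mul_neg_of_neg_of_pos hx h2)]
  · simp
  · rw [Real.sign_of_pos (mul_pos hx h1), Real.sign_of_pos (mul_pos hx h2)]
  · rw [Real.sign_of_pos (mul_pos_of_neg_of_neg hx h1),
      Real.sign_of_pos (mul_pos_of_neg_of_neg hx h2)]
  · simp
  · rw [Real.sign_of_neg (mul_neg_of_pos_of_neg hx h1), Real.sign_of_neg (mul_neg_of_pos_of_neg hx h2)]

/-- On the ball |t| = st with a fixed sign s, so the form is a monic quadratic in t. The inequality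
for m holds because the value at x₀ exceeds m² by y² + x² sin² θ. -/
theorem exists_quad_expansion {x₀ δ : ℝ} (hδ0 : 0 < δ) (hδ : δ < |x₀ / 2|) (x y θ : ℝ) :
    ∃ m : ℝ, m ^ 2 ≤ quad x y x₀ θ ∧ ∀ t ∈ Metric.ball x₀ δ,
      quad x y t θ = quad x y x₀ θ + 2 * m * (t - x₀) + (t - x₀) ^ 2 := by
  have key : ∀ s : ℝ, s ^ 2 = 1 → (∀ t ∈ Metric.ball x₀ δ, |t| = s * t) →
      ∃ m : ℝ, m ^ 2 ≤ quad x y x₀ θ ∧ ∀ t ∈ Metric.ball x₀ δ,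
      quad x y t θ = quad x y x₀ θ + 2 * m * (t - x₀) + (t - x₀) ^ 2 := by
    intro s hs h
    have h0 := h x₀ (Metric.mem_ball_self hδ0)
    refine ⟨x₀ - |x| * s * cos θ, ?_, fun t ht => ?_⟩
    · rw [quad, abs_mul, h0]
      have e : (x₀ - |x| * s * cos θ) ^ 2 =
          x₀ ^ 2 - 2 * (|x| * (s * x₀)) * cos θ + x ^ 2 * cos θ ^ 2 := by
        linear_combination |x| ^ 2 * cos θ ^ 2 * hs + cos θ ^ 2 * sq_abs x
      rw [e]
      nlinarith [sq_nonneg y, mul_le_mul_of_nonneg_left (cos_sq_le_one θ) (sq_nonneg x)]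
    · rw [quad, quad, abs_mul, abs_mul, h t ht, h0]
      ring
  have h0 : x₀ ≠ 0 := by
    rintro rfl
    simp at hδ
    linarith
  rcases lt_or_gt_of_ne h0 with h | h
  · refine key (-1) (by norm_num) fun t ht => ?_
    have := mul_pos_of_mem_ball hδ ht
    rw [abs_of_neg (by nlinarith)]; ring
  · refine key 1 (by norm_num) fun t ht => ?_
    have := mul_pos_of_mem_ball hδ ht
    rw [abs_of_pos (pos_of_mul_pos_left this h.le)]; ring

/-- Exactly one factor 1/√D is spent on 1/y. The exponent that remains is λ + μ with μ = (N+2)/2 ≥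
1, the range of the angular estimate. -/
theorem rpow_mul_div_sqrt_pow_le {D y δ lam : ℝ} (hy : 0 < y) (hD : y ^ 2 ≤ D) (hδ : 0 ≤ δ)
    (N : ℕ) :
    D ^ (-(lam + 1)) * (δ / √D) ^ (N + 1) ≤
      1 / y * δ ^ (N + 1) * D ^ (-(lam + (N + 2) / 2)) := by
  have hD0 : 0 < D := (pow_pos hy 2).trans_le hD
  have hs : y ≤ √D := Real.le_sqrt_of_sq_le hD
  have e : D ^ (-(lam + 1)) * (δ / √D) ^ (N + 1) =
      1 / √D * δ ^ (N + 1) * D ^ (-(lam + (N + 2) / 2)) := by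
    have e1 : D ^ (-(lam + 1)) = D ^ (-(lam + ((N : ℝ) + 2) / 2)) * √D ^ N := by
      rw [Real.sqrt_eq_rpow, ← Real.rpow_mul_natCast hD0.le, ← Real.rpow_add hD0]
      congr 1; ring
    have : 0 < √D := hy.trans_le hs
    rw [e1, div_pow, pow_succ (√D)]
    field_simp
  rw [e]
  gcongr

theorem exists_polynomial_approx_poissonIntegrandDeriv {lam : ℝ} (hlam : 0 < lam) (N : ℕ) :
    ∃ C : ℝ, 0 < C ∧ ∀ x y x₀ δ θ : ℝ, 0 < y → 0 < δ → δ < |x₀ / 2| →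
      16 * δ ^ 2 ≤ (|x| - |x₀|) ^ 2 → ∃ q : Polynomial ℝ, q.natDegree ≤ 2 * N ∧
        ∀ t ∈ Metric.ball x₀ δ,
          |poissonIntegrandDeriv lam x (Real.sign (x * x₀)) y (t, θ) - q.eval t| ≤
            C / y * δ ^ (N + 1) * quad x y x₀ θ ^ (-(lam + (N + 2) / 2)) := by
  obtain ⟨C₁, hC₁, h1⟩ := exists_polynomial_approx_quadratic_rpow (lam + 1) (N + 1)
  obtain ⟨C₂, hC₂, h2⟩ := exists_polynomial_approx_quadratic_rpow (lam + 2) (N + 1)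
  refine ⟨2 * (C₁ + 2 * (lam + 1) * C₂), by positivity, fun x y x₀ δ θ hy hδ0 hδ hfar => ?_⟩
  obtain ⟨m, hm, hexp⟩ := exists_quad_expansion hδ0 hδ x y θ
  set D := quad x y x₀ θ with hDdef
  have hD : 0 < D := quad_pos hy _ _ _
  have hfarD : 16 * δ ^ 2 ≤ D := by
    have := radialPart_le_quad x y x₀ θ
    rw [radialPart] at this
    nlinarith [sq_nonneg y]
  obtain ⟨q₁, -, hd1, hq₁⟩ := h1 D m x₀ δ hD hm hδ0.le hfarD
  obtain ⟨q₂, -, hd2, hq₂⟩ := h2 D m x₀ δ hD hm hδ0.le hfarD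
  simp only [Nat.add_sub_cancel] at hd1 hd2
  set σ := Real.sign (x * x₀) with hσ
  refine ⟨Polynomial.C (1 + σ * cos θ) * (q₁ - Polynomial.C (2 * (lam + 1) * y ^ 2) * q₂), ?_, ?_⟩
  · refine (Polynomial.natDegree_C_mul_le _ _).trans ((Polynomial.natDegree_sub_le _ _).trans ?_)
    exact max_le hd1 ((Polynomial.natDegree_C_mul_le _ _).trans hd2)
  · intro t ht
    have ht' : |t - x₀| ≤ δ := by
      rw [Metric.mem_ball, Real.dist_eq] at ht; exact ht.le
    have b1 := hq₁ t ht'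
    have b2 := hq₂ t ht'
    rw [← hexp t ht] at b1 b2
    have e : poissonIntegrandDeriv lam x σ y (t, θ) - (Polynomial.C (1 + σ * cos θ) *
        (q₁ - Polynomial.C (2 * (lam + 1) * y ^ 2) * q₂)).eval t =
        (1 + σ * cos θ) * ((quad x y t θ ^ (-(lam + 1)) - q₁.eval t) -
          2 * (lam + 1) * y ^ 2 * (quad x y t θ ^ (-(lam + 2)) - q₂.eval t)) := by
      simp [poissonIntegrandDeriv]; ring
    rw [e, abs_mul]
    have hy2 := quad_rpow_mul_sq_le hy lam x x₀ θ
    rw [← hDdef] at hy2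
    set r := (δ / √D) ^ (N + 1) with hr
    have hr0 : 0 ≤ r := by positivity
    calc _ ≤ 2 * (C₁ * D ^ (-(lam + 1)) * r +
          2 * (lam + 1) * y ^ 2 * (C₂ * D ^ (-(lam + 2)) * r)) := by
          gcongr
          · exact abs_one_add_mul_cos_le (abs_sign_le_one _) θ
          · refine (abs_sub _ _).trans (add_le_add b1 ?_)
            rw [abs_mul, abs_of_pos (by positivity : 0 < 2 * (lam + 1) * y ^ 2)]
            gcongr
      _ = 2 * (C₁ * D ^ (-(lam + 1)) * r +
          2 * (lam + 1) * C₂ * (y ^ 2 * D ^ (-(lam + 2))) * r) := by ring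
      _ ≤ 2 * (C₁ * D ^ (-(lam + 1)) * r + 2 * (lam + 1) * C₂ * D ^ (-(lam + 1)) * r) := by
          gcongr
      _ = 2 * (C₁ + 2 * (lam + 1) * C₂) * (D ^ (-(lam + 1)) * r) := by ring
      _ ≤ 2 * (C₁ + 2 * (lam + 1) * C₂) *
          (1 / y * δ ^ (N + 1) * D ^ (-(lam + (N + 2) / 2))) := by
          exact mul_le_mul_of_nonneg_left
            (rpow_mul_div_sqrt_pow_le hy (sq_le_quad _ _ _ _) hδ0.le N) (by positivity)
      _ = _ := by ring

theorem exists_polynomial_approx_conjIntegrandDeriv {lam : ℝ} (hlam : 0 < lam) (N : ℕ) :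
    ∃ C : ℝ, 0 < C ∧ ∀ x y x₀ δ θ : ℝ, 0 < y → 0 < δ → δ < |x₀ / 2| →
      16 * δ ^ 2 ≤ (|x| - |x₀|) ^ 2 → ∃ q : Polynomial ℝ, q.natDegree ≤ 2 * N ∧
        ∀ t ∈ Metric.ball x₀ δ,
          |conjIntegrandDeriv lam x (Real.sign (x * x₀)) y (t, θ) - q.eval t| ≤
            C / y * δ ^ (N + 1) * quad x y x₀ θ ^ (-(lam + (N + 2) / 2)) := by
  obtain ⟨C₁, hC₁, h1⟩ := exists_polynomial_approx_quadratic_rpow (lam + 2) (N + 1)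
  obtain ⟨C₂, hC₂, h2⟩ := exists_polynomial_approx_quadratic_rpow (lam + 2) N
  -- Split x - t = (x - x₀) - (t - x₀). The second piece already carries a factor at most δ, so
  -- order N suffices for it, and its linear factor times degree 2(N-1) still fits into 2N.
  refine ⟨4 * (lam + 1) * (C₁ + C₂), by positivity, fun x y x₀ δ θ hy hδ0 hδ hfar => ?_⟩
  obtain ⟨m, hm, hexp⟩ := exists_quad_expansion hδ0 hδ x y θ
  set D := quad x y x₀ θ with hDdef
  have hD : 0 < D := quad_pos hy _ _ _
  have hsD : 0 < √D := Real.sqrt_pos.2 hD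
  have hfarD : 16 * δ ^ 2 ≤ D := by
    have := radialPart_le_quad x y x₀ θ
    rw [radialPart] at this
    nlinarith [sq_nonneg y]
  obtain ⟨q₁, -, hd1, hq₁⟩ := h1 D m x₀ δ hD hm hδ0.le hfarD
  obtain ⟨q₂, hz2, hd2, hq₂⟩ := h2 D m x₀ δ hD hm hδ0.le hfarD
  simp only [Nat.add_sub_cancel] at hd1
  set σ := Real.sign (x * x₀) with hσ
  refine ⟨Polynomial.C (-(2 * (lam + 1)) * y * (1 + σ * cos θ)) *
    (Polynomial.C (x - x₀) * q₁ - (Polynomial.X - Polynomial.C x₀) * q₂), ?_, ?_⟩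
  · refine (Polynomial.natDegree_C_mul_le _ _).trans ((Polynomial.natDegree_sub_le _ _).trans ?_)
    refine max_le ((Polynomial.natDegree_C_mul_le _ _).trans hd1) ?_
    rcases Nat.eq_zero_or_pos N with hN | hN
    · simp [hz2 hN]
    · refine Polynomial.natDegree_mul_le.trans ?_
      rw [Polynomial.natDegree_X_sub_C]
      omega
  · intro t ht
    have ht' : |t - x₀| ≤ δ := by
      rw [Metric.mem_ball, Real.dist_eq] at ht; exact ht.le
    have b1 := hq₁ t ht'
    have b2 := hq₂ t ht'
    rw [← hexp t ht] at b1 b2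
    have e : conjIntegrandDeriv lam x σ y (t, θ) -
        (Polynomial.C (-(2 * (lam + 1)) * y * (1 + σ * cos θ)) *
          (Polynomial.C (x - x₀) * q₁ - (Polynomial.X - Polynomial.C x₀) * q₂)).eval t =
        -(2 * (lam + 1) * y) * (((x - x₀) * (1 + σ * cos θ)) *
            (quad x y t θ ^ (-(lam + 2)) - q₁.eval t) -
          ((1 + σ * cos θ) * (t - x₀)) * (quad x y t θ ^ (-(lam + 2)) - q₂.eval t)) := by
      simp [conjIntegrandDeriv]; ring
    rw [e, abs_mul, abs_neg, abs_of_pos (by positivity : 0 < 2 * (lam + 1) * y)]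
    have hy2 := quad_rpow_mul_sqrt_le hy lam x x₀ θ
    rw [← hDdef] at hy2
    have hδr : δ * (δ / √D) ^ N = √D * (δ / √D) ^ (N + 1) := by
      rw [pow_succ]; field_simp
    set r := (δ / √D) ^ (N + 1) with hr
    have hr0 : 0 ≤ r := by positivity
    calc _ ≤ 2 * (lam + 1) * y * ((2 * √D) * (C₁ * D ^ (-(lam + 2)) * r) +
          (2 * δ) * (C₂ * D ^ (-(lam + 2)) * (δ / √D) ^ N)) := by
          gcongr
          refine (abs_sub _ _).trans (add_le_add ?_ ?_)
          · rw [abs_mul]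
            gcongr
            exact abs_sub_mul_le_sqrt_quad x y x₀ θ
          · rw [abs_mul, abs_mul (1 + σ * cos θ)]
            gcongr
            exact abs_one_add_mul_cos_le (abs_sign_le_one _) θ
      _ = 2 * (lam + 1) * y * D ^ (-(lam + 2)) * (2 * C₁ * √D * r +
          2 * C₂ * (δ * (δ / √D) ^ N)) := by ring
      _ = 4 * (lam + 1) * (C₁ + C₂) * ((y * √D * D ^ (-(lam + 2))) * r) := by rw [hδr]; ring
      _ ≤ 4 * (lam + 1) * (C₁ + C₂) * (D ^ (-(lam + 1)) * r) := by gcongr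
      _ ≤ 4 * (lam + 1) * (C₁ + C₂) *
          (1 / y * δ ^ (N + 1) * D ^ (-(lam + (N + 2) / 2))) := by
          exact mul_le_mul_of_nonneg_left
            (rpow_mul_div_sqrt_pow_le hy (sq_le_quad _ _ _ _) hδ0.le N) (by positivity)
      _ = _ := by ring

/-! ### Pointwise bounds -/

theorem integrable_inv_sq_add_sq {y : ℝ} (hy : 0 < y) :
    Integrable (fun t : ℝ => (y ^ 2 + t ^ 2)⁻¹) ∧ ∫ t : ℝ, (y ^ 2 + t ^ 2)⁻¹ = π / y := by
  have e : (fun t : ℝ => (y ^ 2 + t ^ 2)⁻¹) = fun t => (y ^ 2)⁻¹ * (1 + (t / y) ^ 2)⁻¹ := by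
    ext t
    rw [← mul_inv]
    congr 1
    field_simp
  rw [e]
  refine ⟨(integrable_inv_one_add_sq.comp_div hy.ne').const_mul _, ?_⟩
  rw [integral_const_mul, Measure.integral_comp_div (fun t => (1 + t ^ 2)⁻¹),
    integral_univ_inv_one_add_sq, abs_of_pos hy, smul_eq_mul]
  field_simp

theorem integrableOn_quad_rpow {lam y : ℝ} (hlam : 0 < lam) (hy : 0 < y) (x t b : ℝ) :
    IntegrableOn (fun θ => quad x y t θ ^ (-b) * sin θ ^ (2 * lam - 1)) (Set.Ioc 0 π) := by
  simp_rw [quad_eq]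
  refine integrableOn_angular hlam ?_ (abs_nonneg _)
  rw [radialPart]
  positivity

theorem integral_quad_rpow_le {lam μ y : ℝ} (hlam : 0 < lam) (hμ : 1 ≤ μ) (hy : 0 < y)
    (x t : ℝ) :
    ∫ θ in Set.Ioc 0 π, quad x y t θ ^ (-(lam + μ)) * sin θ ^ (2 * lam - 1) ≤
      2 ^ (lam + 1) / lam * (radialPart x y t ^ (-μ) * (y ^ 2 + x ^ 2 + t ^ 2) ^ (-lam)) := by
  simp_rw [quad_eq]
  rw [← radialPart_add]
  refine integral_angular_le hlam hμ ?_ (abs_nonneg _)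
  rw [radialPart]
  positivity

theorem inv_radialPart_le {y : ℝ} (hy : 0 < y) (x t : ℝ) :
    (radialPart x y t)⁻¹ ≤ (y ^ 2 + (t - x) ^ 2)⁻¹ + (y ^ 2 + (t + x) ^ 2)⁻¹ := by
  have h1 : 0 ≤ (y ^ 2 + (t - x) ^ 2)⁻¹ := by positivity
  have h2 : 0 ≤ (y ^ 2 + (t + x) ^ 2)⁻¹ := by positivity
  have : radialPart x y t = y ^ 2 + (t - x) ^ 2 ∨ radialPart x y t = y ^ 2 + (t + x) ^ 2 := by
    rw [radialPart]
    rcases abs_choice x with h | h <;> rcases abs_choice t with h' | h' <;> rw [h, h'] <;>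
      [left; right; right; left] <;> ring
  rcases this with h | h <;> rw [h] <;> linarith

/-- No cancellation is used: after the angular integration the weight |t|^(2λ) is absorbed, and two
translates of the Cauchy kernel, centred at ±x, majorize what is left. -/
theorem norm_integral_prod_le_local {lam y M C x x₀ δ B : ℝ} (hlam : 0 < lam) (hy : 0 < y)
    (hC : 0 ≤ C) (hM : 0 ≤ M) {a : ℝ → ℂ} (ha : ∀ᵐ t, ‖a t‖ ≤ M)
    (hw : Integrable fun t => |t| ^ (2 * lam) • a t)
    (hwS : Function.support (fun t => |t| ^ (2 * lam) • a t) ⊆ Metric.ball x₀ δ)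
    {K : ℝ × ℝ → ℝ} (hK : Measurable K)
    (hB : ∀ z : ℝ × ℝ, z.1 ∈ Metric.ball x₀ δ → |K z| ≤ B)
    (hKb : ∀ t ∈ Metric.ball x₀ δ, ∀ θ, |K (t, θ)| ≤ C * quad x y t θ ^ (-(lam + 1))) :
    ‖∫ z : ℝ × ℝ, (K z * sin z.2 ^ (2 * lam - 1)) • (|z.1| ^ (2 * lam) • a z.1)
      ∂(volume.prod (volume.restrict (Set.Ioc 0 π)))‖ ≤
      C * (2 ^ (lam + 1) / lam) * M * (2 * π / y) := by
  obtain ⟨hi, hint⟩ := integrable_inv_sq_add_sq hy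
  have hi1 : Integrable fun t : ℝ => (y ^ 2 + (t - x) ^ 2)⁻¹ := hi.comp_sub_right x
  have hi2 : Integrable fun t : ℝ => (y ^ 2 + (t + x) ^ 2)⁻¹ := hi.comp_add_right x
  set c := C * (2 ^ (lam + 1) / lam) * M with hc
  have hc0 : 0 ≤ c := by positivity
  have hH : ∫ t : ℝ, c * ((y ^ 2 + (t - x) ^ 2)⁻¹ + (y ^ 2 + (t + x) ^ 2)⁻¹) =
      c * (2 * π / y) := by
    rw [integral_const_mul, integral_add hi1 hi2,
      integral_sub_right_eq_self (fun t : ℝ => (y ^ 2 + t ^ 2)⁻¹),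
      integral_add_right_eq_self (fun t : ℝ => (y ^ 2 + t ^ 2)⁻¹), hint]
    ring
  rw [← hH]
  refine norm_integral_prod_le_of_size (g := fun θ => sin θ ^ (2 * lam - 1))
    (w := fun t => |t| ^ (2 * lam) • a t) measurableSet_Ioc
    (integrableOn_sin_rpow hlam) (fun θ hθ => sin_rpow_nonneg hθ) hw hwS hK hB
    (b := fun t θ => C * quad x y t θ ^ (-(lam + 1))) ?_ hKb ((hi1.add hi2).const_mul c) ?_ ?_
  · intro t _
    simp_rw [mul_assoc]
    exact (integrableOn_quad_rpow hlam hy x t (lam + 1)).const_mul C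
  · intro t
    positivity
  · filter_upwards [ha] with t hat _
    simp_rw [mul_assoc C]
    rw [integral_const_mul, norm_smul, Real.norm_of_nonneg (by positivity)]
    have h1 := integral_quad_rpow_le hlam le_rfl hy x t
    have hr : 0 < radialPart x y t := by rw [radialPart]; positivity
    have hq : 0 < y ^ 2 + x ^ 2 + t ^ 2 := by positivity
    have h2 : (y ^ 2 + x ^ 2 + t ^ 2) ^ (-lam) * |t| ^ (2 * lam) ≤ 1 := by
      rw [Real.rpow_mul (abs_nonneg t), Real.rpow_two, sq_abs, Real.rpow_neg hq.le,
        inv_mul_le_one₀ (by positivity)]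
      exact Real.rpow_le_rpow (sq_nonneg t) (by nlinarith [sq_nonneg y, sq_nonneg x]) hlam.le
    have h3 := inv_radialPart_le hy x t
    rw [Real.rpow_neg_one] at h1
    calc _ ≤ C * (2 ^ (lam + 1) / lam * ((radialPart x y t)⁻¹ *
          (y ^ 2 + x ^ 2 + t ^ 2) ^ (-lam))) * (|t| ^ (2 * lam) * M) := by gcongr
      _ = c * ((radialPart x y t)⁻¹ * ((y ^ 2 + x ^ 2 + t ^ 2) ^ (-lam) * |t| ^ (2 * lam))) := by
          rw [hc]; ring
      _ ≤ c * ((radialPart x y t)⁻¹ * 1) := by gcongr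
      _ ≤ _ := by rw [mul_one]; gcongr

/-- Cancellation in t replaces the kernel by its remainder, which involves the quadratic only at t =
x₀; one angular integral at that point then finishes. -/
theorem norm_integral_prod_le_far {lam y C x x₀ δ B : ℝ} (hlam : 0 < lam) (hy : 0 < y)
    (hC : 0 ≤ C) {w : ℝ → ℂ} (hw : Integrable w) (hδ : 0 < δ)
    (hwS : Function.support w ⊆ Metric.ball x₀ δ) {N κ : ℕ} (hκ : 2 * N ≤ κ)
    (hmom : ∀ k ≤ κ, ∫ t : ℝ, t ^ k • w t = 0)
    {K : ℝ × ℝ → ℝ} (hK : Measurable K)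
    (hB : ∀ z : ℝ × ℝ, z.1 ∈ Metric.ball x₀ δ → |K z| ≤ B)
    (hfar : 16 * δ ^ 2 ≤ (|x| - |x₀|) ^ 2)
    (hq : ∀ θ, ∃ q : Polynomial ℝ, q.natDegree ≤ 2 * N ∧ ∀ t ∈ Metric.ball x₀ δ,
      |K (t, θ) - q.eval t| ≤
        C / y * δ ^ (N + 1) * quad x y x₀ θ ^ (-(lam + (N + 2) / 2))) :
    ‖∫ z : ℝ × ℝ, (K z * sin z.2 ^ (2 * lam - 1)) • w z.1
      ∂(volume.prod (volume.restrict (Set.Ioc 0 π)))‖ ≤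
      C * (2 ^ (lam + 1) / lam) / y * δ ^ (N + 1) * (|(|x| - |x₀|)| ^ (-((N : ℝ) + 2)) *
        (x ^ 2 + x₀ ^ 2) ^ (-lam)) * ∫ t, ‖w t‖ := by
  have hx₀ : 0 < |x| - |x₀| ∨ |x| - |x₀| < 0 := by
    rcases lt_trichotomy (|x| - |x₀|) 0 with h | h | h
    · exact Or.inr h
    · rw [h] at hfar; nlinarith [pow_pos hδ 2]
    · exact Or.inl h
  have hd : 0 < |(|x| - |x₀|)| := by
    rcases hx₀ with h | h
    · exact abs_pos.2 h.ne'
    · exact abs_pos.2 h.ne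
  have hsum : 0 < x ^ 2 + x₀ ^ 2 := by
    by_contra hcon
    have h1 : x = 0 := by nlinarith [sq_nonneg x, sq_nonneg x₀]
    have h2 : x₀ = 0 := by nlinarith [sq_nonneg x, sq_nonneg x₀]
    simp [h1, h2] at hd
  have hb : IntegrableOn (fun θ => C / y * δ ^ (N + 1) *
      quad x y x₀ θ ^ (-(lam + ((N : ℝ) + 2) / 2)) * sin θ ^ (2 * lam - 1)) (Set.Ioc 0 π) := by
    simp_rw [mul_assoc (C / y * δ ^ (N + 1))]
    exact (integrableOn_quad_rpow hlam hy x x₀ _).const_mul _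
  refine (norm_integral_prod_le_of_cancellation (g := fun θ => sin θ ^ (2 * lam - 1))
    (b := fun θ => C / y * δ ^ (N + 1) * quad x y x₀ θ ^ (-(lam + ((N : ℝ) + 2) / 2)))
    measurableSet_Ioc (integrableOn_sin_rpow hlam)
    (fun θ hθ => sin_rpow_nonneg hθ) hw hwS hmom hK hB hb fun θ => ?_).trans ?_
  · obtain ⟨q, hqd, hqB⟩ := hq θ
    exact ⟨q, hqd.trans hκ, hqB⟩
  · refine mul_le_mul_of_nonneg_right ?_ (integral_nonneg fun _ => norm_nonneg _)
    simp_rw [mul_assoc (C / y * δ ^ (N + 1))]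
    rw [integral_const_mul]
    have hN : (0 : ℝ) ≤ N := N.cast_nonneg
    have h1 := integral_quad_rpow_le (μ := ((N : ℝ) + 2) / 2) hlam (by linarith) hy x x₀
    have h2 : radialPart x y x₀ ^ (-(((N : ℝ) + 2) / 2)) ≤ |(|x| - |x₀|)| ^ (-((N : ℝ) + 2)) := by
      have e : |(|x| - |x₀|)| ^ (-((N : ℝ) + 2)) =
          ((|x| - |x₀|) ^ 2) ^ (-(((N : ℝ) + 2) / 2)) := by
        rw [← sq_abs (|x| - |x₀|), ← Real.rpow_two, ← Real.rpow_mul (abs_nonneg _)]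
        congr 1; ring
      rw [e]
      refine Real.rpow_le_rpow_of_nonpos (by rw [← sq_abs]; positivity) ?_ (by linarith)
      rw [radialPart]; nlinarith [sq_nonneg y]
    have h3 : (y ^ 2 + x ^ 2 + x₀ ^ 2) ^ (-lam) ≤ (x ^ 2 + x₀ ^ 2) ^ (-lam) :=
      Real.rpow_le_rpow_of_nonpos hsum (by nlinarith [sq_nonneg y]) (by linarith)
    have hr : 0 < radialPart x y x₀ := by rw [radialPart]; positivity
    calc _ ≤ C / y * δ ^ (N + 1) * (2 ^ (lam + 1) / lam *
          (|(|x| - |x₀|)| ^ (-((N : ℝ) + 2)) * (x ^ 2 + x₀ ^ 2) ^ (-lam))) := by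
          refine mul_le_mul_of_nonneg_left (h1.trans ?_) (by positivity)
          gcongr
      _ = _ := by ring

/-! ### The weighted quasi-norm of a profile concentrated near `±x₀` -/

theorem intervalMass_integrableOn {lam : ℝ} (hlam : 0 < lam) (x₀ δ : ℝ) :
    IntegrableOn (fun x : ℝ => |x| ^ (2 * lam)) (Metric.ball x₀ δ) := by
  have hc : Continuous fun x : ℝ => |x| ^ (2 * lam) :=
    continuous_abs.rpow_const fun _ => Or.inr (by positivity)
  exact (hc.continuousOn.integrableOn_compact (isCompact_closedBall x₀ δ)).mono_set
    Metric.ball_subset_closedBall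

theorem le_intervalMass {lam x₀ δ : ℝ} (hlam : 0 < lam) (hδ0 : 0 < δ) (hδ : δ < |x₀ / 2|) :
    2 * (1 / 2) ^ (2 * lam) * (δ * |x₀| ^ (2 * lam)) ≤ intervalMass lam x₀ δ := by
  rw [abs_div, abs_two] at hδ
  have h : ∫ _ in Metric.ball x₀ δ, (1 / 2 * |x₀|) ^ (2 * lam) ≤ intervalMass lam x₀ δ := by
    refine setIntegral_mono_on ?_ (intervalMass_integrableOn hlam x₀ δ) measurableSet_ball ?_
    · exact integrableOn_const measure_ball_lt_top.ne
    · intro t ht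
      rw [Metric.mem_ball, Real.dist_eq] at ht
      have : |x₀| ≤ |t - x₀| + |t| := by
        calc |x₀| = |t - (t - x₀)| := by congr 1; ring
          _ ≤ |t| + |t - x₀| := abs_sub _ _
          _ = _ := add_comm _ _
      exact Real.rpow_le_rpow (by positivity) (by linarith) (by positivity)
  refine le_trans (le_of_eq ?_) h
  rw [setIntegral_const, measureReal_def, Real.volume_ball, ENNReal.toReal_ofReal (by linarith),
    Real.mul_rpow (by norm_num) (abs_nonneg _), smul_eq_mul]
  ring

theorem rpow_neg_le_five_rpow {u γ : ℝ} (hu : 4 ≤ u) (hγ : 0 ≤ γ) :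
    u ^ (-γ) ≤ 5 ^ γ * (1 + u) ^ (-γ) := by
  have h : (1 + u) / 5 ≤ u := by linarith
  refine (Real.rpow_le_rpow_of_nonpos (by positivity) h (by linarith)).trans (le_of_eq ?_)
  rw [Real.div_rpow (by linarith) (by norm_num), Real.rpow_neg (by norm_num : (0 : ℝ) ≤ 5)]
  field_simp

theorem one_le_five_rpow {u γ : ℝ} (hu0 : 0 ≤ u) (hu : u ≤ 4) (hγ : 0 ≤ γ) :
    1 ≤ 5 ^ γ * (1 + u) ^ (-γ) := by
  rw [Real.rpow_neg (by linarith), ← div_eq_mul_inv, one_le_div (by positivity)]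
  exact Real.rpow_le_rpow (by linarith) (by linarith) hγ

/-- Here |x| ≤ |x₀| + 4δ ≤ 3|x₀|, so the weight is comparable to the one inside m and only 1/δ
survives. -/
theorem local_profile_le {lam p x₀ δ m T x v : ℝ} (hlam : 0 < lam) (hp0 : 0 < p)
    (hδ0 : 0 < δ) (hδ : δ < |x₀ / 2|) (hT : 0 ≤ T) {k : ℝ} (hk : 0 < k)
    (hm : k * (δ * |x₀| ^ (2 * lam)) ≤ m) (hx : |(|x| - |x₀|)| ≤ 4 * δ) (hv0 : 0 ≤ v)
    (hv : v ≤ T / m ^ (1 / p)) :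
    v ^ p * |x| ^ (2 * lam) ≤ k⁻¹ * 3 ^ (2 * lam) * (T ^ p * δ⁻¹) := by
  rw [abs_div, abs_two] at hδ
  have hR : 0 < |x₀| := by linarith
  have hV : 0 < k * (δ * |x₀| ^ (2 * lam)) := by positivity
  have hm0 : 0 < m := hV.trans_le hm
  have h1 : v ^ p ≤ T ^ p * m⁻¹ := by
    refine (Real.rpow_le_rpow hv0 hv hp0.le).trans (le_of_eq ?_)
    rw [Real.div_rpow hT (by positivity), ← Real.rpow_mul hm0.le, one_div,
      inv_mul_cancel₀ hp0.ne', Real.rpow_one, div_eq_mul_inv]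
  have h2 : |x| ^ (2 * lam) ≤ 3 ^ (2 * lam) * |x₀| ^ (2 * lam) := by
    rw [← Real.mul_rpow (by norm_num) hR.le]
    refine Real.rpow_le_rpow (abs_nonneg _) ?_ (by positivity)
    have := (abs_le.1 hx).2
    linarith
  calc v ^ p * |x| ^ (2 * lam)
      ≤ (T ^ p * (k * (δ * |x₀| ^ (2 * lam)))⁻¹) * (3 ^ (2 * lam) * |x₀| ^ (2 * lam)) := by
        refine mul_le_mul (h1.trans ?_) h2 (by positivity) (by positivity)
        gcongr
    _ = _ := by
        have : |x₀| ^ (2 * lam) ≠ 0 := by positivity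
        field_simp

/-- For p < 1 the weight beats (x² + x₀²)^(-λp) and leaves growth of order β = 2λ(1-p). The factor
m^(p-1) supplies |x₀|^(-β), which makes this growth dimensionless, and |x₀| > δ bounds it by a power
of u = s/δ. The powers of δ add up to -1. -/
theorem far_profile_le {lam p x₀ δ m T x v : ℝ} {N : ℕ} (hlam : 0 < lam) (hp0 : 0 < p)
    (hp1 : p ≤ 1) (hδ0 : 0 < δ) (hδ : δ < |x₀ / 2|) (hT : 0 ≤ T) {k : ℝ} (hk : 0 < k)
    (hm : k * (δ * |x₀| ^ (2 * lam)) ≤ m) (hx : 4 * δ ≤ |(|x| - |x₀|)|) (hv0 : 0 ≤ v)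
    (hv : v ≤ T * (δ ^ (N + 1) * (|(|x| - |x₀|)| ^ (-((N : ℝ) + 2)) *
      (x ^ 2 + x₀ ^ 2) ^ (-lam)) * (m / m ^ (1 / p)))) :
    v ^ p * |x| ^ (2 * lam) ≤ k ^ (p - 1) * 2 ^ (2 * lam * (1 - p)) * (T ^ p * δ⁻¹ *
      (|(|x| - |x₀|)| / δ) ^ (-((N + 2) * p - 2 * lam * (1 - p)))) := by
  rw [abs_div, abs_two] at hδ
  have hR : 0 < |x₀| := by linarith
  have hV : 0 < k * (δ * |x₀| ^ (2 * lam)) := by positivity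
  have hm0 : 0 < m := hV.trans_le hm
  set s := |(|x| - |x₀|)| with hs
  have hs0 : 0 < s := by linarith
  set β := 2 * lam * (1 - p) with hβ
  have hβ0 : 0 ≤ β := mul_nonneg (by positivity) (by linarith)
  set u := s / δ with hu
  have hu4 : 4 ≤ u := by rw [hu, le_div_iff₀ hδ0]; linarith
  have hu0 : 0 < u := by linarith
  have hsu : s = u * δ := by rw [hu]; field_simp
  have hq0 : 0 < x ^ 2 + x₀ ^ 2 := by
    have : 0 < x₀ ^ 2 := by rw [← sq_abs]; positivity
    positivity
  have h1 : v ^ p ≤ T ^ p * ((δ ^ (N + 1)) ^ p * ((s ^ (-((N : ℝ) + 2))) ^ p *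
      ((x ^ 2 + x₀ ^ 2) ^ (-lam)) ^ p) * m ^ (p - 1)) := by
    refine (Real.rpow_le_rpow hv0 hv hp0.le).trans (le_of_eq ?_)
    rw [Real.mul_rpow hT (by positivity), Real.mul_rpow (by positivity) (by positivity),
      Real.mul_rpow (by positivity) (by positivity), Real.mul_rpow (by positivity) (by positivity),
      Real.div_rpow hm0.le (by positivity), ← Real.rpow_mul hm0.le, one_div,
      inv_mul_cancel₀ hp0.ne', ← Real.rpow_sub hm0]
  have h2 : m ^ (p - 1) ≤ k ^ (p - 1) * (δ ^ (p - 1) * |x₀| ^ (-β)) := by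
    refine (Real.rpow_le_rpow_of_nonpos hV hm (by linarith)).trans (le_of_eq ?_)
    rw [Real.mul_rpow hk.le (by positivity), Real.mul_rpow hδ0.le (by positivity),
      ← Real.rpow_mul hR.le, hβ]
    congr 3; ring
  have h3 : ((x ^ 2 + x₀ ^ 2) ^ (-lam)) ^ p * |x| ^ (2 * lam) ≤ (s + 2 * |x₀|) ^ β := by
    have e : |x| ^ (2 * lam) ≤ (x ^ 2 + x₀ ^ 2) ^ lam := by
      rw [Real.rpow_mul (abs_nonneg x), Real.rpow_two, sq_abs]
      exact Real.rpow_le_rpow (sq_nonneg _) (by nlinarith [sq_nonneg x₀]) hlam.le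
    have hxs : |x| ≤ s + |x₀| := by
      have := le_abs_self (|x| - |x₀|)
      linarith
    have hq : x ^ 2 + x₀ ^ 2 ≤ (s + 2 * |x₀|) ^ 2 := by
      rw [← sq_abs x, ← sq_abs x₀]
      nlinarith [abs_nonneg x]
    calc _ ≤ ((x ^ 2 + x₀ ^ 2) ^ (-lam)) ^ p * (x ^ 2 + x₀ ^ 2) ^ lam := by gcongr
      _ = (x ^ 2 + x₀ ^ 2) ^ (lam * (1 - p)) := by
          rw [← Real.rpow_mul hq0.le, ← Real.rpow_add hq0]; congr 1; ring
      _ ≤ ((s + 2 * |x₀|) ^ 2) ^ (lam * (1 - p)) :=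
          Real.rpow_le_rpow hq0.le hq (mul_nonneg hlam.le (by linarith))
      _ = _ := by
          rw [← Real.rpow_two, ← Real.rpow_mul (by positivity), hβ]
          congr 1; ring
  have h4 : |x₀| ^ (-β) * (s + 2 * |x₀|) ^ β ≤ 2 ^ β * u ^ β := by
    rw [Real.rpow_neg hR.le, ← Real.inv_rpow hR.le, ← Real.mul_rpow (by positivity) (by positivity),
      ← Real.mul_rpow (by norm_num) hu0.le]
    refine Real.rpow_le_rpow (by positivity) ?_ hβ0
    have : |x₀|⁻¹ * (s + 2 * |x₀|) = s / |x₀| + 2 := by field_simp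
    rw [this]
    have : s / |x₀| ≤ u := by
      rw [hu]
      exact div_le_div_of_nonneg_left hs0.le hδ0 (by linarith)
    linarith
  have h5 : (δ ^ (N + 1)) ^ p * (s ^ (-((N : ℝ) + 2))) ^ p * δ ^ (p - 1) =
      δ⁻¹ * u ^ (-((N + 2) * p)) := by
    rw [hsu, Real.mul_rpow hu0.le hδ0.le, Real.mul_rpow (by positivity) (by positivity),
      ← Real.rpow_natCast, ← Real.rpow_mul hδ0.le, ← Real.rpow_mul hu0.le, ← Real.rpow_mul hδ0.le,
      show -((N + 2) * p) = -((N : ℝ) + 2) * p by ring, ← Real.rpow_neg_one δ]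
    have : δ ^ (-1 : ℝ) = δ ^ (((N + 1 : ℕ) : ℝ) * p) * δ ^ (-((N : ℝ) + 2) * p) * δ ^ (p - 1) := by
      rw [← Real.rpow_add hδ0, ← Real.rpow_add hδ0]
      congr 1; push_cast; ring
    rw [this]; ring
  calc v ^ p * |x| ^ (2 * lam)
      ≤ (T ^ p * ((δ ^ (N + 1)) ^ p * ((s ^ (-((N : ℝ) + 2))) ^ p *
      ((x ^ 2 + x₀ ^ 2) ^ (-lam)) ^ p) * (k ^ (p - 1) * (δ ^ (p - 1) * |x₀| ^ (-β))))) *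
        |x| ^ (2 * lam) := by
        refine mul_le_mul_of_nonneg_right (h1.trans ?_) (by positivity)
        gcongr
    _ = k ^ (p - 1) * T ^ p * ((δ ^ (N + 1)) ^ p * (s ^ (-((N : ℝ) + 2))) ^ p * δ ^ (p - 1)) *
        (|x₀| ^ (-β) * (((x ^ 2 + x₀ ^ 2) ^ (-lam)) ^ p * |x| ^ (2 * lam))) := by ring
    _ ≤ k ^ (p - 1) * T ^ p * ((δ ^ (N + 1)) ^ p * (s ^ (-((N : ℝ) + 2))) ^ p * δ ^ (p - 1)) *
        (2 ^ β * u ^ β) := by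
        refine mul_le_mul_of_nonneg_left (le_trans ?_ h4) (by positivity)
        gcongr
    _ = _ := by
        rw [h5, show -((N + 2) * p - β) = -((N + 2) * p) + β by ring, Real.rpow_add hu0]
        ring

theorem lintegral_profile_le {δ γ R D : ℝ} (hδ : 0 < δ) (hγ : 1 < γ) (hD : 0 ≤ D) :
    ∫⁻ x : ℝ, ENNReal.ofReal (D * (δ⁻¹ * (1 + |(|x| - |R|)| / δ) ^ (-γ))) ≤
      ENNReal.ofReal (D * (2 * ∫ u : ℝ, (1 + |u|) ^ (-γ))) := by
  have hi : Integrable fun u : ℝ => (1 + |u|) ^ (-γ) := by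
    have := integrable_one_add_norm (E := ℝ) (μ := volume) (r := γ) (by simpa using hγ)
    simpa using this
  set f : ℝ → ℝ := fun x => δ⁻¹ * (1 + |x / δ|) ^ (-γ) with hf
  have hf0 : ∀ x, 0 ≤ f x := fun x => by simp only [hf]; positivity
  have hfi : Integrable f := (hi.comp_div hδ.ne').const_mul _
  have hfint : ∫ x, f x = ∫ u : ℝ, (1 + |u|) ^ (-γ) := by
    rw [hf, integral_const_mul, Measure.integral_comp_div (fun u : ℝ => (1 + |u|) ^ (-γ)),
      abs_of_pos hδ, smul_eq_mul, inv_mul_cancel_left₀ hδ.ne']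
  have hi1 : Integrable fun x => f (x - R) := hfi.comp_sub_right R
  have hi2 : Integrable fun x => f (x + R) := hfi.comp_add_right R
  have hH : ∫ x, D * (f (x - R) + f (x + R)) = D * (2 * ∫ u : ℝ, (1 + |u|) ^ (-γ)) := by
    rw [integral_const_mul, integral_add hi1 hi2, integral_sub_right_eq_self f,
      integral_add_right_eq_self f, hfint]
    ring
  have hiD : Integrable fun x => D * (f (x - R) + f (x + R)) := (hi1.add hi2).const_mul D
  rw [← hH, ofReal_integral_eq_lintegral_ofReal hiD
    (Filter.Eventually.of_forall fun x => mul_nonneg hD (add_nonneg (hf0 _) (hf0 _)))]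
  refine lintegral_mono fun x => ENNReal.ofReal_le_ofReal (mul_le_mul_of_nonneg_left ?_ hD)
  have : |(|x| - |R|)| = |x - R| ∨ |(|x| - |R|)| = |x + R| := by
    rcases abs_choice x with h | h <;> rcases abs_choice R with h' | h' <;> rw [h, h']
    · left; rfl
    · right; congr 1; ring
    · right; rw [← abs_neg]; congr 1; ring
    · left; rw [← abs_neg]; congr 1; ring
  have e : ∀ z : ℝ, δ⁻¹ * (1 + |z| / δ) ^ (-γ) = f z := fun z => by
    simp only [hf, abs_div, abs_of_pos hδ]
  rcases this with h | h <;> rw [h, e]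
  · linarith [hf0 (x + R)]
  · linarith [hf0 (x - R)]

theorem exists_weightedLpNorm_le {lam p : ℝ} (hlam : 0 < lam) (hp0 : 0 < p) (hp1 : p ≤ 1) {N : ℕ}
    (hN : (2 * lam + 1) * ((1 - p) / p) < N + 1) :
    ∃ C : ℝ, 0 < C ∧ ∀ (x₀ δ T : ℝ) (F : ℝ → ℂ), 0 < δ → δ < |x₀ / 2| → 0 ≤ T →
      (∀ x, (|x| - |x₀|) ^ 2 < 16 * δ ^ 2 → ‖F x‖ ≤ T / intervalMass lam x₀ δ ^ (1 / p)) →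
      (∀ x, 16 * δ ^ 2 ≤ (|x| - |x₀|) ^ 2 →
        ‖F x‖ ≤ T * (δ ^ (N + 1) * (|(|x| - |x₀|)| ^ (-((N : ℝ) + 2)) *
          (x ^ 2 + x₀ ^ 2) ^ (-lam)) *
          (intervalMass lam x₀ δ / intervalMass lam x₀ δ ^ (1 / p)))) →
      weightedLpNorm lam p F ≤ ENNReal.ofReal (C * T) := by
  set k : ℝ := 2 * (1 / 2) ^ (2 * lam) with hk
  have hk0 : 0 < k := by positivity
  set γ : ℝ := (N + 2) * p - 2 * lam * (1 - p) with hγdef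
  have hγ : 1 < γ := by
    rw [← mul_div_assoc, div_lt_iff₀ hp0] at hN
    rw [hγdef]; linarith
  set C₁ : ℝ := (k⁻¹ * 3 ^ (2 * lam) + k ^ (p - 1) * 2 ^ (2 * lam * (1 - p))) * 5 ^ γ with hC₁
  have hC₁0 : 0 < C₁ := by positivity
  set I : ℝ := ∫ u : ℝ, (1 + |u|) ^ (-γ) with hI
  have hI0 : 0 ≤ I := integral_nonneg fun u => by positivity
  -- Adding 1 makes the constant positive without proving that I is.
  refine ⟨(C₁ * (2 * I)) ^ (1 / p) + 1, by positivity,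
    fun x₀ δ T F hδ0 hδ hT hloc hfar => ?_⟩
  have hm := le_intervalMass hlam hδ0 hδ
  rw [← hk] at hm
  have hpt : ∀ x, ‖F x‖ ^ p * |x| ^ (2 * lam) ≤
      (C₁ * T ^ p) * (δ⁻¹ * (1 + |(|x| - |x₀|)| / δ) ^ (-γ)) := by
    intro x
    set s := |(|x| - |x₀|)| with hs
    have hs0 : 0 ≤ s := abs_nonneg _
    have hssq : s ^ 2 = (|x| - |x₀|) ^ 2 := sq_abs _
    rcases lt_or_ge ((|x| - |x₀|) ^ 2) (16 * δ ^ 2) with h | h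
    · have hx : s ≤ 4 * δ := by
        rw [← hssq] at h; nlinarith
      have h1 := local_profile_le hlam hp0 hδ0 hδ hT hk0 hm hx (norm_nonneg _) (hloc x h)
      have h2 : 1 ≤ 5 ^ γ * (1 + s / δ) ^ (-γ) :=
        one_le_five_rpow (by positivity) (by rw [div_le_iff₀ hδ0]; exact hx) (by linarith)
      refine h1.trans ?_
      calc _ ≤ k⁻¹ * 3 ^ (2 * lam) * (T ^ p * δ⁻¹) * (5 ^ γ * (1 + s / δ) ^ (-γ)) :=
            le_mul_of_one_le_right (by positivity) h2
        _ ≤ (k⁻¹ * 3 ^ (2 * lam) + k ^ (p - 1) * 2 ^ (2 * lam * (1 - p))) * (T ^ p * δ⁻¹) *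
            (5 ^ γ * (1 + s / δ) ^ (-γ)) := by
            gcongr
            exact le_add_of_nonneg_right (by positivity)
        _ = _ := by rw [hC₁]; ring
    · have hx : 4 * δ ≤ s := by
        rw [← hssq] at h; nlinarith
      have h1 := far_profile_le hlam hp0 hp1 hδ0 hδ hT hk0 hm hx (norm_nonneg _) (hfar x h)
      have h2 : (s / δ) ^ (-γ) ≤ 5 ^ γ * (1 + s / δ) ^ (-γ) :=
        rpow_neg_le_five_rpow (by rw [le_div_iff₀ hδ0]; exact hx) (by linarith)
      refine h1.trans ?_
      calc _ ≤ k ^ (p - 1) * 2 ^ (2 * lam * (1 - p)) * (T ^ p * δ⁻¹ *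
            (5 ^ γ * (1 + s / δ) ^ (-γ))) := by gcongr
        _ ≤ (k⁻¹ * 3 ^ (2 * lam) + k ^ (p - 1) * 2 ^ (2 * lam * (1 - p))) * (T ^ p * δ⁻¹ *
            (5 ^ γ * (1 + s / δ) ^ (-γ))) := by
            gcongr
            exact le_add_of_nonneg_left (by positivity)
        _ = _ := by rw [hC₁]; ring
  have hint := (lintegral_mono fun x => ENNReal.ofReal_le_ofReal (hpt x)).trans
    (lintegral_profile_le (R := x₀) hδ0 hγ (by positivity : 0 ≤ C₁ * T ^ p))
  rw [weightedLpNorm]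
  calc _ ≤ ENNReal.ofReal (C₁ * T ^ p * (2 * I)) ^ (1 / p) :=
        ENNReal.rpow_le_rpow hint (by positivity)
    _ = ENNReal.ofReal ((C₁ * (2 * I)) ^ (1 / p) * T) := by
        rw [ENNReal.ofReal_rpow_of_nonneg (by positivity) (by positivity)]
        congr 1
        rw [show C₁ * T ^ p * (2 * I) = (C₁ * (2 * I)) * T ^ p by ring,
          Real.mul_rpow (by positivity) (by positivity), ← Real.rpow_mul hT,
          mul_one_div_cancel hp0.ne', Real.rpow_one]
    _ ≤ _ := by
        apply ENNReal.ofReal_le_ofReal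
        gcongr
        linarith

/-! ### Atoms -/

theorem norm_le_of_eLpNorm_top_le {a : ℝ → ℂ} {M : ℝ} (hM : 0 ≤ M)
    (h : eLpNorm a ∞ volume ≤ ENNReal.ofReal M) : ∀ᵐ t, ‖a t‖ ≤ M := by
  rw [eLpNorm_exponent_top] at h
  filter_upwards [ae_le_eLpNormEssSup (f := a) (μ := volume)] with t ht
  have := ht.trans h
  rwa [← ofReal_norm, ENNReal.ofReal_le_ofReal_iff hM] at this

theorem integrable_weight_smul {lam x₀ δ M : ℝ} (hlam : 0 < lam) {a : ℝ → ℂ}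
    (ham : AEStronglyMeasurable a volume) (ha : ∀ᵐ t, ‖a t‖ ≤ M)
    (haS : Function.support a ⊆ Metric.ball x₀ δ) :
    Integrable (fun t => |t| ^ (2 * lam) • a t) ∧
      ∫ t, ‖|t| ^ (2 * lam) • a t‖ ≤ M * intervalMass lam x₀ δ := by
  have hI : Integrable ((Metric.ball x₀ δ).indicator fun t : ℝ => M * |t| ^ (2 * lam)) :=
    (integrable_indicator_iff measurableSet_ball).2
      ((intervalMass_integrableOn hlam x₀ δ).const_mul M)
  have hc : Continuous fun x : ℝ => |x| ^ (2 * lam) :=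
    continuous_abs.rpow_const fun _ => Or.inr (by positivity)
  have hbd : ∀ᵐ t : ℝ, ‖|t| ^ (2 * lam) • a t‖ ≤
      (Metric.ball x₀ δ).indicator (fun t : ℝ => M * |t| ^ (2 * lam)) t := by
    filter_upwards [ha] with t ht
    by_cases hb : t ∈ Metric.ball x₀ δ
    · rw [Set.indicator_of_mem hb, norm_smul, Real.norm_of_nonneg (by positivity), mul_comm]
      gcongr
    · have h0 : a t = 0 := by
        by_contra h
        exact hb (haS h)
      simp [Set.indicator_of_notMem hb, h0]
  have hint : Integrable (fun t => |t| ^ (2 * lam) • a t) :=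
    Integrable.mono' hI (hc.aestronglyMeasurable.smul ham) hbd
  refine ⟨hint, (integral_mono_ae hint.norm hI hbd).trans (le_of_eq ?_)⟩
  rw [integral_indicator measurableSet_ball, integral_const_mul, intervalMass]

/-- Isolates what the two kernels share: a size bound and a polynomial approximation for the
differentiated integrand. The sign is a separate parameter of k because it can be frozen at sgn(x
x₀) on the support of the atom. -/
theorem exists_atom_bound {lam p : ℝ} (hlam : 0 < lam) (hp0 : 0 < p) (hp1 : p ≤ 1)
    (c₀ c₁ : ℝ) {Φ : ℝ → ℝ → ℝ → ℝ} {k k' : ℝ → ℝ → ℝ → ℝ × ℝ → ℝ}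
    (hΦ : ∀ y x t, Φ y x t =
      c₀ * ∫ θ in (0 : ℝ)..π, k x (Real.sign (x * t)) y (t, θ) * sin θ ^ (2 * lam - 1))
    (hk : ∀ x σ y, Measurable (k x σ y)) (hk' : ∀ x σ y, Measurable (k' x σ y))
    (hd : ∀ x σ y z, 0 < y → HasDerivAt (fun y => k x σ y z) (k' x σ y z) y)
    (hB : ∀ x σ y x₀ δ, 0 < y → |σ| ≤ 1 → ∃ B : ℝ, ∀ s ∈ Metric.ball y (y / 2), ∀ z : ℝ × ℝ,
      z.1 ∈ Metric.ball x₀ δ → |k x σ s z| ≤ B ∧ |k' x σ s z| ≤ B)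
    {C₁ : ℝ} (hC₁ : 0 ≤ C₁) (hloc : ∀ x y t θ, 0 < y →
      |k' x (Real.sign (x * t)) y (t, θ)| ≤ C₁ * quad x y t θ ^ (-(lam + 1)))
    (hfar : ∀ N : ℕ, ∃ C : ℝ, 0 < C ∧ ∀ x y x₀ δ θ : ℝ, 0 < y → 0 < δ → δ < |x₀ / 2| →
      16 * δ ^ 2 ≤ (|x| - |x₀|) ^ 2 → ∃ q : Polynomial ℝ, q.natDegree ≤ 2 * N ∧
        ∀ t ∈ Metric.ball x₀ δ, |k' x (Real.sign (x * x₀)) y (t, θ) - q.eval t| ≤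
            C / y * δ ^ (N + 1) * quad x y x₀ θ ^ (-(lam + (N + 2) / 2))) :
    ∃ C : ℝ, 0 < C ∧ ∀ (A : ℝ) (a : ℝ → ℂ), 0 < A → IsAtom lam p A a →
      (∀ x y : ℝ, 0 < y →
        DifferentiableAt ℝ (fun s => c₁ • ∫ t, (Φ s x t * |t| ^ (2 * lam)) • a t) y) ∧
      ∀ y : ℝ, 0 < y → weightedLpNorm lam p
        (fun x => deriv (fun s => c₁ • ∫ t, (Φ s x t * |t| ^ (2 * lam)) • a t) y) ≤
          ENNReal.ofReal (C * A / y) := by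
  set s₀ : ℝ := (2 * lam + 1) * ((1 - p) / p) with hs₀
  have hs₀0 : 0 ≤ s₀ := by
    have : 0 ≤ 1 - p := by linarith
    positivity
  -- This N serves both ends: 2N ≤ κ by the moment condition, and s₀ < N + 1 makes the far profile
  -- integrable.
  set N : ℕ := ⌊s₀⌋₊ with hNdef
  have hNfloor : (N : ℤ) = ⌊s₀⌋ := Int.natCast_floor_eq_floor hs₀0
  obtain ⟨C₂, hC₂, hfar⟩ := hfar N
  obtain ⟨C₃, hC₃, hnorm⟩ := exists_weightedLpNorm_le hlam hp0 hp1 (N := N) (Nat.lt_floor_add_one s₀)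
  set G : ℝ := 2 ^ (lam + 1) / lam with hG
  have hG0 : 0 < G := by positivity
  set c : ℝ := |c₁ * c₀| * (C₁ * G * (2 * π) + C₂ * G) with hc
  have hc0 : 0 ≤ c := by positivity
  -- The prefactors c₀ and c₁ are arbitrary here, so c may vanish; the added 1 keeps the constant
  -- positive.
  refine ⟨C₃ * c + 1, by positivity, fun A a hA hatom => ?_⟩
  obtain ⟨ham, x₀, δ, hδ0, hδ, haN, haS, κ, hκ, hmom⟩ := hatom
  have hm0 : 0 < intervalMass lam x₀ δ := by
    refine lt_of_lt_of_le ?_ (le_intervalMass hlam hδ0 hδ)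
    have : x₀ ≠ 0 := by
      rintro rfl
      simp at hδ
      linarith
    positivity
  set m := intervalMass lam x₀ δ with hm
  set M := A / m ^ (1 / p) with hM
  have hM0 : 0 ≤ M := by positivity
  have ha := norm_le_of_eLpNorm_top_le hM0 haN
  obtain ⟨hw, hwn⟩ := integrable_weight_smul hlam ham ha haS
  have hwS : Function.support (fun t => |t| ^ (2 * lam) • a t) ⊆ Metric.ball x₀ δ :=
    fun t ht => haS fun h => ht (by simp [h])
  have hκN : 2 * N ≤ κ := by
    rw [← hNfloor] at hκ
    exact_mod_cast hκ
  have hmom' : ∀ j ≤ κ, ∫ t : ℝ, t ^ j • (|t| ^ (2 * lam) • a t) = 0 := fun j hj => by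
    simpa only [smul_smul] using hmom j hj
  set L : ℝ → ℝ → ℂ := fun x y => ∫ z : ℝ × ℝ,
    (k' x (Real.sign (x * x₀)) y z * sin z.2 ^ (2 * lam - 1)) • (|z.1| ^ (2 * lam) • a z.1)
      ∂(volume.prod (volume.restrict (Set.Ioc 0 π))) with hL
  have heq : ∀ x s, c₁ • ∫ t, (Φ s x t * |t| ^ (2 * lam)) • a t =
      (c₁ * c₀) • ∫ t, (∫ θ in (0 : ℝ)..π, k x (Real.sign (x * x₀)) s (t, θ) *
        sin θ ^ (2 * lam - 1)) • (|t| ^ (2 * lam) • a t) := by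
    intro x s
    rw [mul_smul, ← integral_smul c₀]
    congr 2
    ext1 t
    by_cases ht : a t = 0
    · simp [ht]
    · rw [hΦ, sign_mul_eq_of_mem_ball hδ (haS ht), smul_smul, smul_smul, mul_assoc]
  have hderiv : ∀ x y, 0 < y → HasDerivAt
      (fun s => c₁ • ∫ t, (Φ s x t * |t| ^ (2 * lam)) • a t) ((c₁ * c₀) • L x y) y := by
    intro x y hy
    simp_rw [heq]
    obtain ⟨B, hB⟩ := hB x _ y x₀ δ hy (abs_sign_le_one (x * x₀))
    refine (hasDerivAt_integral_prod (integrableOn_sin_rpow hlam) hw hwS (half_pos hy)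
      (k := fun s z => k x (Real.sign (x * x₀)) s z)
      (k' := fun s z => k' x (Real.sign (x * x₀)) s z)
      (fun s _ => hk x _ s) (hk' x _ y) (fun s hs z hz => (hB s hs z hz).1)
      (fun s hs z hz => (hB s hs z hz).2) fun s hs z => hd x _ s z ?_).const_smul (c₁ * c₀)
    rw [Metric.mem_ball, Real.dist_eq, abs_lt] at hs
    linarith
  refine ⟨fun x y hy => (hderiv x y hy).differentiableAt, fun y hy => ?_⟩
  have e : (fun x => deriv (fun s => c₁ • ∫ t, (Φ s x t * |t| ^ (2 * lam)) • a t) y) =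
      fun x => (c₁ * c₀) • L x y := funext fun x => (hderiv x y hy).deriv
  rw [e]
  -- A single amplitude T = cA/y covers both regimes, since c contains the sum of the local and the
  -- far constants.
  refine (hnorm x₀ δ (c * A / y) _ hδ0 hδ (by positivity) (fun x _ => ?_) fun x hx => ?_).trans ?_
  · obtain ⟨B, hB⟩ := hB x _ y x₀ δ hy (abs_sign_le_one (x * x₀))
    rw [norm_smul, Real.norm_eq_abs]
    have h := norm_integral_prod_le_local hlam hy hC₁ hM0 ha hw hwS
      (hk' x (Real.sign (x * x₀)) y)
      (fun z hz => (hB y (Metric.mem_ball_self (half_pos hy)) z hz).2)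
      (fun t ht θ => by
        rw [← sign_mul_eq_of_mem_ball hδ ht]
        exact hloc x y t θ hy)
    calc _ ≤ |c₁ * c₀| * (C₁ * G * M * (2 * π / y)) := by gcongr
      _ = |c₁ * c₀| * (C₁ * G * (2 * π)) * A / y / m ^ (1 / p) := by rw [hM]; ring
      _ ≤ _ := by
        rw [hc]
        gcongr
        exact le_add_of_nonneg_right (by positivity)
  · obtain ⟨B, hB⟩ := hB x _ y x₀ δ hy (abs_sign_le_one (x * x₀))
    rw [norm_smul, Real.norm_eq_abs]
    have h := norm_integral_prod_le_far hlam hy hC₂.le hw hδ0 hwS hκN hmom'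
      (hk' x (Real.sign (x * x₀)) y)
      (fun z hz => (hB y (Metric.mem_ball_self (half_pos hy)) z hz).2) hx
      (fun θ => hfar x y x₀ δ θ hy hδ0 hδ hx)
    set X := |(|x| - |x₀|)| ^ (-((N : ℝ) + 2)) * (x ^ 2 + x₀ ^ 2) ^ (-lam) with hX
    have hX0 : 0 ≤ X := by positivity
    calc _ ≤ |c₁ * c₀| * (C₂ * G / y * δ ^ (N + 1) * X * (M * m)) := by
          gcongr
          exact h.trans (by gcongr)
      _ = |c₁ * c₀| * (C₂ * G) * A / y * (δ ^ (N + 1) * X * (m / m ^ (1 / p))) := by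
          rw [hM]; ring
      _ ≤ _ := by
        rw [hc]
        gcongr
        exact le_add_of_nonneg_left (by positivity)
  · refine ENNReal.ofReal_le_ofReal ?_
    rw [← mul_div_assoc, ← mul_assoc]
    gcongr
    linarith

end DunklLine

theorem mainTheorem6 (lam p : ℝ) (hlam : 0 < lam)
    (hp : 2 * lam / (2 * lam + 1) < p) (hp1 : p ≤ 1) :
    ∃ C : ℝ, 0 < C ∧ ∀ (A : ℝ) (a : ℝ → ℂ), 0 < A → DunklLine.IsAtom lam p A a →
      (∀ x y : ℝ, 0 < y →
        DifferentiableAt ℝ (fun s => DunklLine.poissonIntegral lam a x s) y ∧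
        DifferentiableAt ℝ (fun s => DunklLine.conjPoissonIntegral lam a x s) y) ∧
      ∀ y : ℝ, 0 < y →
        DunklLine.weightedLpNorm lam p
            (fun x => deriv (fun s => DunklLine.poissonIntegral lam a x s) y) ≤
          ENNReal.ofReal (C * A / y) ∧
        DunklLine.weightedLpNorm lam p
            (fun x => deriv (fun s => DunklLine.conjPoissonIntegral lam a x s) y) ≤
          ENNReal.ofReal (C * A / y) := by
  have hp0 : 0 < p := lt_of_le_of_lt (by positivity) hp
  have hC₁ : (0 : ℝ) ≤ 4 * lam + 6 := by positivity
  obtain ⟨C, hC, hP⟩ := DunklLine.exists_atom_bound hlam hp0 hp1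
    (lam * Real.Gamma (lam + 1 / 2) / ((2 : ℝ) ^ (-lam - 1 / 2) * π)) (DunklLine.cConst lam)
    (Φ := DunklLine.poissonKernel lam) (fun _ _ _ => rfl)
    (DunklLine.measurable_poissonIntegrand lam) (DunklLine.measurable_poissonIntegrandDeriv lam)
    (fun x σ _ z hy => DunklLine.hasDerivAt_poissonIntegrand hy lam x σ z)
    (fun x σ y x₀ δ hy hσ => by
      obtain ⟨B, hB⟩ := DunklLine.exists_bound_integrands (x := x) (x₀ := x₀) (δ := δ) hlam hy hσ
      exact ⟨B, fun s hs z hz => ⟨(hB s hs z hz).1, (hB s hs z hz).2.1⟩⟩)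
    hC₁
    (fun x _ t θ hy => DunklLine.abs_poissonIntegrandDeriv_le hlam hy
      (DunklLine.abs_sign_le_one (x * t)) (t, θ))
    (DunklLine.exists_polynomial_approx_poissonIntegrandDeriv hlam)
  obtain ⟨C', hC', hQ⟩ := DunklLine.exists_atom_bound hlam hp0 hp1
    (lam * Real.Gamma (lam + 1 / 2) / ((2 : ℝ) ^ (-lam - 1 / 2) * π)) (DunklLine.cConst lam)
    (Φ := DunklLine.conjPoissonKernel lam) (k := DunklLine.conjIntegrand lam) (fun _ _ _ => rfl)
    (DunklLine.measurable_conjIntegrand lam) (DunklLine.measurable_conjIntegrandDeriv lam)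
    (fun x σ _ z hy => DunklLine.hasDerivAt_conjIntegrand hy lam x σ z)
    (fun x σ y x₀ δ hy hσ => by
      obtain ⟨B, hB⟩ := DunklLine.exists_bound_integrands (x := x) (x₀ := x₀) (δ := δ) hlam hy hσ
      exact ⟨B, fun s hs z hz => (hB s hs z hz).2.2⟩)
    hC₁
    (fun _ _ t θ hy => DunklLine.abs_conjIntegrandDeriv_le hlam hy (t, θ))
    (DunklLine.exists_polynomial_approx_conjIntegrandDeriv hlam)
  refine ⟨max C C', lt_max_of_lt_left hC, fun A a hA ha => ⟨fun x y hy =>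
    ⟨(hP A a hA ha).1 x y hy, (hQ A a hA ha).1 x y hy⟩, fun y hy => ⟨?_, ?_⟩⟩⟩
  · refine ((hP A a hA ha).2 y hy).trans (ENNReal.ofReal_le_ofReal ?_)
    gcongr
    exact le_max_left _ _
  · refine ((hQ A a hA ha).2 y hy).trans (ENNReal.ofReal_le_ofReal ?_)
    gcongr
    exact le_max_right _ _
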